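/- \textbf{Definitions.} An instance of \textsc{Min-Color Path} consists of an undirected graph $G=(V,E)$ with $n$ vertices, a coloring function $\sigma:V\to 2^{[m]}$, and two vertices $s,t$; the goal is to find an $s$-$t$ path $\pi$ minimizing the number of distinct colors $\left|\bigcup_{v\in\pi}\sigma(v)\right|$. The instance is \emph{color-connected} if for every color $c\in[m]$ the set of vertices $v$ with $c\in\sigma(v)$ is connected in $G$. A graph is a \emph{diamond path} if it is obtained from a path by replacing each edge $uv$ by one or more vertices of degree $2$, each adjacent to $u$ and $v$. For a positive integer $N$, $\mathcal G(N,p,r)$ denotes the random $r$-uniform hypergraph on $N$ vertices in which every set of $r$ vertices is a hyperedge independently with probability $p$. \emph{With high probability} means with probability at least $1-O(N^{-c})$ for some constant $c>0$. \textbf{Dense vs Random conjecture.} For every constant $r$, all constants $0<\beta<\alpha<r-1$, and every function $k:\mathbb N\to\mathbb N$ with $k(N)\le N$ that grows polynomially (that is, $k(N)\ge N^{c}$ for some constant $c>0$ and all large $N$) and satisfies $k(N)^{1+\beta}\le N^{(1+\alpha)/2}$, there is no randomized polynomial-time algorithm that takes an $r$-uniform hypergraph $\mathcal H$ on $N$ vertices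 as input, outputs either \textsf{dense} or \textsf{sparse}, and satisfies both of the following conditions. \begin{itemize} \item For every $\mathcal H$ that contains an induced subhypergraph with $k(N)$ vertices and at least $k(N)^{1+\beta}$ hyperedges, it outputs \textsf{dense} with high probability over its random bits. \item If $\mathcal H$ is drawn from $\mathcal G(N,p,r)$ with $p=N^{\alpha-(r-1)}$, it outputs \textsf{sparse} with high probability over the draw of $\mathcal H$ and its random bits. \end{itemize} \textbf{Theorem.} Assume the Dense vs Random conjecture. Then for every $\varepsilon>0$ there is no polynomial-time algorithm that approximates \textsc{Min-Color Path} within ratio $O(m^{1-\varepsilon})$, and there is none that approximates it within ratio $O(n^{1/4-\varepsilon})$, where $m$ is the number of colors and $n$ is the number of vertices of $G$. Both bounds hold even on each of the following two restricted classes of instances: \begin{enumerate} \item $G$ is a diamond path; \item $G$ has a vertex $v$ such that $G-v$ is a diamond path, and $(G,\sigma)$ is color-connected. \end{enumerate} -/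

import Mathlib

namespace MinColorPath

/-! ### Machine model: structured programs on binary trees with a step count -/

/-- The data handled by programs: binary trees with unlabelled leaves. -/
inductive Data : Type
  | nil : Data
  | cons : Data → Data → Data

/-- The size of a datum: its number of nodes. -/
def Data.size : Data → ℕ
  | .nil => 1
  | .cons a b => a.size + b.size + 1

/-- Lists as data (right-nested, terminated by `nil`). -/
def Data.ofList : List Data → Data
  | [] => .nil
  | a :: l => .cons a (Data.ofList l)

/-- Natural numbers as data, in unary. -/
def Data.ofNat : ℕ → Data
  | 0 => .nil
  | n + 1 => .cons .nil (Data.ofNat n)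

/-- Booleans as data. -/
def Data.ofBool : Bool → Data
  | false => .nil
  | true => .cons .nil .nil

/-- Programs of a WHILE language on binary trees. A program transforms one datum into another:
the constant `nil`, the identity, head and tail, pairing of two results, composition
(`comp f g` runs `g` first), case distinction and unbounded iteration. -/
inductive Prog : Type
  | nil : Prog
  | id : Prog
  | head : Prog
  | tail : Prog
  | pair : Prog → Prog → Prog
  | comp : Prog → Prog → Prog
  | ite : Prog → Prog → Prog → Prog
  | loop : Prog → Prog → Prog

/-- `Runs p x y t`: on input `x`, program `p` halts with output `y` after `t` steps.
Every instruction that is executed costs the size of the datum it is applied to, so that all the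
data that is read, copied or built is paid for node by node; up to a polynomial, this is the
running time of a Turing machine. -/
inductive Prog.Runs : Prog → Data → Data → ℕ → Prop
  | nil (x : Data) : Runs .nil x .nil x.size
  | id (x : Data) : Runs .id x x x.size
  | head_nil : Runs .head .nil .nil Data.nil.size
  | head_cons (a b : Data) : Runs .head (.cons a b) a (Data.cons a b).size
  | tail_nil : Runs .tail .nil .nil Data.nil.size
  | tail_cons (a b : Data) : Runs .tail (.cons a b) b (Data.cons a b).size
  | pair {f g : Prog} {x a b : Data} {t₁ t₂ : ℕ} :
      Runs f x a t₁ → Runs g x b t₂ → Runs (.pair f g) x (.cons a b) (t₁ + t₂ + x.size)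
  | comp {f g : Prog} {x y z : Data} {t₁ t₂ : ℕ} :
      Runs g x y t₁ → Runs f y z t₂ → Runs (.comp f g) x z (t₁ + t₂ + x.size)
  | ite_true {c f g : Prog} {x y u v : Data} {t₁ t₂ : ℕ} :
      Runs c x (.cons u v) t₁ → Runs f x y t₂ → Runs (.ite c f g) x y (t₁ + t₂ + x.size)
  | ite_false {c f g : Prog} {x y : Data} {t₁ t₂ : ℕ} :
      Runs c x .nil t₁ → Runs g x y t₂ → Runs (.ite c f g) x y (t₁ + t₂ + x.size)
  | loop_stop {c f : Prog} {x : Data} {t : ℕ} :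
      Runs c x .nil t → Runs (.loop c f) x x (t + x.size)
  | loop_step {c f : Prog} {x y z u v : Data} {t₁ t₂ t₃ : ℕ} :
      Runs c x (.cons u v) t₁ → Runs f x y t₂ → Runs (.loop c f) y z t₃ →
      Runs (.loop c f) x z (t₁ + t₂ + t₃ + x.size)

/-- Programs are deterministic: output and number of steps are determined by the input. -/
theorem Prog.Runs.unique {p : Prog} {x y y' : Data} {t t' : ℕ}
    (h : p.Runs x y t) (h' : p.Runs x y' t') : y = y' ∧ t = t' := by
  induction h generalizing y' t' with
  | nil | id | head_nil | head_cons | tail_nil | tail_cons => cases h'; exact ⟨rfl, rfl⟩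
  | pair _ _ ih₁ ih₂ =>
    cases h' with
    | pair k₁ k₂ =>
      obtain ⟨rfl, rfl⟩ := ih₁ k₁
      obtain ⟨rfl, rfl⟩ := ih₂ k₂
      exact ⟨rfl, rfl⟩
  | comp _ _ ih₁ ih₂ =>
    cases h' with
    | comp k₁ k₂ =>
      obtain ⟨rfl, rfl⟩ := ih₁ k₁
      obtain ⟨rfl, rfl⟩ := ih₂ k₂
      exact ⟨rfl, rfl⟩
  | ite_true _ _ ih₁ ih₂ =>
    cases h' with
    | ite_true k₁ k₂ =>
      obtain ⟨-, rfl⟩ := ih₁ k₁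
      obtain ⟨rfl, rfl⟩ := ih₂ k₂
      exact ⟨rfl, rfl⟩
    | ite_false k₁ k₂ => exact absurd (ih₁ k₁).1 (by simp)
  | ite_false _ _ ih₁ ih₂ =>
    cases h' with
    | ite_true k₁ k₂ => exact absurd (ih₁ k₁).1 (by simp)
    | ite_false k₁ k₂ =>
      obtain ⟨-, rfl⟩ := ih₁ k₁
      obtain ⟨rfl, rfl⟩ := ih₂ k₂
      exact ⟨rfl, rfl⟩
  | loop_stop _ ih₁ =>
    cases h' with
    | loop_stop k₁ =>
      obtain ⟨-, rfl⟩ := ih₁ k₁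
      exact ⟨rfl, rfl⟩
    | loop_step k₁ k₂ k₃ => exact absurd (ih₁ k₁).1 (by simp)
  | loop_step _ _ _ ih₁ ih₂ ih₃ =>
    cases h' with
    | loop_stop k₁ => exact absurd (ih₁ k₁).1 (by simp)
    | loop_step k₁ k₂ k₃ =>
      obtain ⟨-, rfl⟩ := ih₁ k₁
      obtain ⟨rfl, rfl⟩ := ih₂ k₂
      obtain ⟨rfl, rfl⟩ := ih₃ k₃
      exact ⟨rfl, rfl⟩

/-- The input of a randomized program: the actual input together with a string of random bits. -/
def withCoins {L : ℕ} (x : Data) (ω : Fin L → Bool) : Data :=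
  .cons x (Data.ofList ((List.ofFn ω).map Data.ofBool))

open Classical in
/-- The probability that `p`, given the input `x` and `L` independent fair random bits,
outputs `y`. -/
noncomputable def outputProb (p : Prog) (L : ℕ) (x y : Data) : ℝ :=
  ((Finset.univ.filter fun ω : Fin L → Bool => ∃ t, p.Runs (withCoins x ω) y t).card : ℝ) / 2 ^ L

/-! ### Uniform hypergraphs and the Dense vs Random conjecture -/

/-- The `r`-uniform hypergraphs with vertex set `Fin n`, each given by its set of hyperedges. -/
def uniformHypergraphs (n r : ℕ) : Finset (Finset (Finset (Fin n))) :=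
  (Finset.powersetCard r Finset.univ).powerset

/-- The encoding of an `r`-uniform hypergraph: the number of vertices and the list of hyperedges,
each of them the increasing list of its vertices. -/
def encodeHypergraph (n r : ℕ) (H : Finset (Finset (Fin n))) : Data :=
  .cons (Data.ofNat n)
    (Data.ofList ((((List.finRange n).sublistsLen r).filter fun e => e.toFinset ∈ H).map
      fun e => Data.ofList (e.map fun v => Data.ofNat v)))

/-- The probability of `H` in the model `𝒢(n, p, r)`, where every set of `r` vertices is a
hyperedge independently with probability `p`. -/
noncomputable def randomHypergraphProb (n r : ℕ) (p : ℝ) (H : Finset (Finset (Fin n))) : ℝ :=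
  p ^ H.card * (1 - p) ^ (n.choose r - H.card)

/-- `H` has an induced subhypergraph with `k` vertices and at least `q` hyperedges. -/
def HasDenseSubhypergraph {n : ℕ} (H : Finset (Finset (Fin n))) (k : ℕ) (q : ℝ) : Prop :=
  ∃ S : Finset (Fin n), S.card = k ∧ q ≤ ((H.filter fun e => e ⊆ S).card : ℝ)

/-- There is a randomized polynomial-time algorithm which takes an `r`-uniform hypergraph on `n`
vertices, always answers "dense" (`true`) or "sparse" (`false`), answers "dense" with high
probability whenever there is an induced subhypergraph with `k n` vertices and at least
`(k n) ^ (1 + β)` hyperedges, and answers "sparse" with high probability over `𝒢(n, p, r)` with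
`p = n ^ (α - (r - 1))`. The polynomial `L` bounds the number of random bits, `T` the number of
steps; with high probability means with probability at least `1 - O(n ^ (-c))` for some `c > 0`. -/
def DenseVsRandomSolvable (r : ℕ) (α β : ℝ) (k : ℕ → ℕ) : Prop :=
  ∃ (p : Prog) (L T : Polynomial ℕ),
    (∀ n : ℕ, ∀ H ∈ uniformHypergraphs n r,
      ∀ ω : Fin (L.eval (encodeHypergraph n r H).size) → Bool,
        ∃ (b : Bool) (t : ℕ), p.Runs (withCoins (encodeHypergraph n r H) ω) (Data.ofBool b) t ∧
          t ≤ T.eval (encodeHypergraph n r H).size) ∧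
    (∃ c C : ℝ, 0 < c ∧ ∀ n : ℕ, 1 ≤ n → ∀ H ∈ uniformHypergraphs n r,
      HasDenseSubhypergraph H (k n) ((k n : ℝ) ^ (1 + β)) →
        1 - C * (n : ℝ) ^ (-c) ≤
          outputProb p (L.eval (encodeHypergraph n r H).size) (encodeHypergraph n r H)
            (Data.ofBool true)) ∧
    (∃ c C : ℝ, 0 < c ∧ ∀ n : ℕ, 1 ≤ n →
        1 - C * (n : ℝ) ^ (-c) ≤
          ∑ H ∈ uniformHypergraphs n r,
            randomHypergraphProb n r ((n : ℝ) ^ (α - ((r : ℝ) - 1))) H *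
              outputProb p (L.eval (encodeHypergraph n r H).size) (encodeHypergraph n r H)
                (Data.ofBool false))

/-- The Dense vs Random conjecture: for every constant uniformity `r`, log-densities
`0 < β < α < r - 1`, and every `k : ℕ → ℕ` with `k n ≤ n` that grows polynomially and satisfies
`(k n) ^ (1 + β) ≤ n ^ ((1 + α) / 2)`, no randomized polynomial-time algorithm distinguishes. -/
def DenseVsRandomConjecture : Prop :=
  ∀ (r : ℕ) (α β : ℝ), 0 < β → β < α → α < (r : ℝ) - 1 →
    ∀ k : ℕ → ℕ, (∀ n, k n ≤ n) →
      (∃ c : ℝ, 0 < c ∧ ∀ᶠ n : ℕ in Filter.atTop, (n : ℝ) ^ c ≤ (k n : ℝ)) →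
      (∀ n : ℕ, (k n : ℝ) ^ (1 + β) ≤ (n : ℝ) ^ ((1 + α) / 2)) →
        ¬ DenseVsRandomSolvable r α β k

/-! ### Min-Color Path -/

/-- An instance of Min-Color Path: a graph with vertex set `Fin n`, a set of colors from
`Fin m` on every vertex, a source `s` and a destination `t`. -/
structure Instance where
  n : ℕ
  m : ℕ
  G : SimpleGraph (Fin n)
  σ : Fin n → Finset (Fin m)
  s : Fin n
  t : Fin n

/-- The number of distinct colors on a walk. -/
def Instance.numColors (I : Instance) {u v : Fin I.n} (w : I.G.Walk u v) : ℕ :=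
  (w.support.toFinset.biUnion I.σ).card

open Classical in
/-- The encoding of an instance: numbers of vertices and colors, adjacency matrix,
vertex-color incidence matrix, source and destination. -/
noncomputable def Instance.encode (I : Instance) : Data :=
  Data.ofList
    [ Data.ofNat I.n,
      Data.ofNat I.m,
      Data.ofList (List.ofFn fun u =>
        Data.ofList (List.ofFn fun v => Data.ofBool (decide (I.G.Adj u v)))),
      Data.ofList (List.ofFn fun u =>
        Data.ofList (List.ofFn fun c => Data.ofBool (decide (c ∈ I.σ u)))),
      Data.ofNat I.s,
      Data.ofNat I.t ]

/-- The encoding of a walk: its list of vertices. -/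
def Instance.encodeWalk (I : Instance) {u v : Fin I.n} (w : I.G.Walk u v) : Data :=
  Data.ofList (w.support.map fun x => Data.ofNat x)

/-- Some polynomial-time algorithm computes, for every instance `I` in the class `P` that has an
`s`-`t` path at all, an `s`-`t` path whose number of colors is at most `ρ I` times that of any
other `s`-`t` path. -/
def PolyTimeApproximable (P : Instance → Prop) (ρ : Instance → ℝ) : Prop :=
  ∃ (p : Prog) (T : Polynomial ℕ), ∀ I : Instance, P I → I.G.Reachable I.s I.t →
    ∃ (w : I.G.Walk I.s I.t) (τ : ℕ),
      p.Runs I.encode (I.encodeWalk w) τ ∧ τ ≤ T.eval I.encode.size ∧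
      w.IsPath ∧
      ∀ w' : I.G.Walk I.s I.t, w'.IsPath → (I.numColors w : ℝ) ≤ ρ I * (I.numColors w' : ℝ)

/-- The graph obtained from the path with vertices `0, …, ℓ` by replacing its `i`-th edge
`{i, i + 1}` by `d i` vertices of degree two, each of them adjacent to `i` and `i + 1`. -/
def diamondPath (ℓ : ℕ) (d : Fin ℓ → ℕ) : SimpleGraph (Fin (ℓ + 1) ⊕ (Σ i : Fin ℓ, Fin (d i))) :=
  SimpleGraph.fromRel fun x y =>
    match x, y with
    | .inl v, .inr e => v = e.1.castSucc ∨ v = e.1.succ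
    | _, _ => False

/-- `G` is a diamond path. Every edge is replaced by at least one vertex. -/
def IsDiamondPath {V : Type*} (G : SimpleGraph V) : Prop :=
  ∃ (ℓ : ℕ) (d : Fin ℓ → ℕ), (∀ i, 1 ≤ d i) ∧ Nonempty (G ≃g diamondPath ℓ d)

/-- For every color, the set of vertices that contain it is connected. -/
def Instance.ColorConnected (I : Instance) : Prop :=
  ∀ c : Fin I.m, (I.G.induce {v | c ∈ I.σ v}).Connected

/-- For no constant `C`, Min-Color Path on the class `P` has a polynomial-time approximation
algorithm with ratio `C * m ^ (1 - ε)`, and likewise for `C * n ^ (1 / 4 - ε)`. -/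
def HardToApproximate (P : Instance → Prop) (ε : ℝ) : Prop :=
  (∀ C : ℝ, ¬ PolyTimeApproximable P fun I => C * (I.m : ℝ) ^ (1 - ε)) ∧
  (∀ C : ℝ, ¬ PolyTimeApproximable P fun I => C * (I.n : ℝ) ^ (1 / 4 - ε))

end MinColorPath

/-!
An approximation algorithm for Min-Color Path is turned into a distinguisher for dense and random
hypergraphs.

Let `H` be an `r`-uniform hypergraph on `n` vertices. With `ℓ` the largest power of two up to `n`,
throw the hyperedges of `H` independently into `ℓ` groups and form a diamond path with connectors
`0, …, ℓ` whose `i`-th edge is replaced by the hyperedges of group `i`. The colors are the vertices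
of `H`, and every hyperedge has its own vertices as colors (`reductionInstance`). Optionally an apex
with all colors is joined to everything, which makes the instance color-connected and offers no
cheap detour.

* If `k` vertices span `k ^ (1 + β) ≥ n ^ (1 + τ)` hyperedges, then with high probability every
  group contains one of them (`le_card_hit`), which gives a path with at most `k` colors
  (`exists_path_of_hit`).
* Every path that avoids the apex contains a hyperedge of each of the `ℓ ≥ n / 2` groups
  (`exists_edges_of_walk`). In a random hypergraph with `p = n ^ (α - (r - 1))`, the probability that
  some set of `u = n ^ (1 - 1 / B)` vertices spans `ℓ` hyperedges is at most
  `n ^ u * (u ^ r * p) ^ ℓ` by the union bound (`sum_concentrated_le`). This tends to zero if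
  `r > B * (1 + α)`, so that with high probability every path has more than `n ^ (1 - 1 / B)` colors.

An approximation ratio below `n ^ (1 - 1 / B) / k` therefore separates the two cases. With
`k = n ^ κ` for a small constant `κ` this excludes the ratio `m ^ (1 - ε)`, where `m = n`. For the
number of vertices one takes `k = n ^ (1 / 2)` with `α` and `β` slightly larger than `1`: the graph
has about `n ^ 2` vertices, as hypergraphs with more hyperedges are declared dense right away, which
is justified by Markov's inequality (`sum_many_edges_le`), and the gap is about `n ^ (1 / 2)`.

The distinguisher has to be a program of the machine model. Programs are built through the predicate
`PolyTime` on functions between types with a `DataEncoding`, which is closed under composition,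
arithmetic, list operations and iteration with polynomially bounded intermediate results
(`PolyTime.foldl`); the distinguisher is put together in `exists_decider`.
-/

namespace MinColorPath

open Filter

/-! ### Polynomial-time functions between encoded types -/

/-- A type whose elements are presented to programs as binary trees. -/
class DataEncoding (α : Type) where
  /-- The tree that represents an element. -/
  enc : α → Data

open DataEncoding (enc)

instance : DataEncoding Unit := ⟨fun _ => .nil⟩

instance : DataEncoding ℕ := ⟨Data.ofNat⟩

instance : DataEncoding Bool := ⟨Data.ofBool⟩

instance {α β : Type} [DataEncoding α] [DataEncoding β] : DataEncoding (α × β) :=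
  ⟨fun x => .cons (enc x.1) (enc x.2)⟩

instance {α : Type} [DataEncoding α] : DataEncoding (List α) :=
  ⟨fun l => Data.ofList (l.map enc)⟩

/-- The size of the tree that represents an element. -/
def encSize {α : Type} [DataEncoding α] (a : α) : ℕ := (enc a).size

/-- `f` is computed by some program in a number of steps that is polynomial in the size of the
encoded argument. The program has to be correct on encodings of elements of `α` only. -/
@[fun_prop]
def PolyTime {α β : Type} [DataEncoding α] [DataEncoding β] (f : α → β) : Prop :=
  ∃ (p : Prog) (T : Polynomial ℕ), ∀ a, ∃ t, p.Runs (enc a) (enc (f a)) t ∧ t ≤ T.eval (encSize a)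

theorem eval_mono (T : Polynomial ℕ) {a b : ℕ} (h : a ≤ b) : T.eval a ≤ T.eval b := by
  rw [Polynomial.eval_eq_sum_range, Polynomial.eval_eq_sum_range]
  gcongr

theorem Data.one_le_size (x : Data) : 1 ≤ x.size := by
  cases x <;> simp [Data.size]

/-- The output of a program is built node by node. -/
theorem Prog.Runs.size_le {p : Prog} {x y : Data} {t : ℕ} (h : p.Runs x y t) : y.size ≤ t := by
  induction h with
  | nil x => exact x.one_le_size
  | id | head_nil | tail_nil => exact le_rfl
  | head_cons a b | tail_cons a b => simp only [Data.size]; omega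
  | @pair f g x a b t₁ t₂ _ _ ih₁ ih₂ =>
    have := x.one_le_size
    simp only [Data.size]; omega
  | _ => omega

section Basic

variable {α β γ δ : Type} [DataEncoding α] [DataEncoding β] [DataEncoding γ] [DataEncoding δ]

theorem one_le_encSize (a : α) : 1 ≤ encSize a := Data.one_le_size _

theorem encSize_prod (a : α) (b : β) : encSize (a, b) = encSize a + encSize b + 1 := rfl

theorem encSize_nil : encSize ([] : List α) = 1 := rfl

theorem encSize_cons (a : α) (l : List α) : encSize (a :: l) = encSize a + encSize l + 1 := rfl

theorem encSize_nat (n : ℕ) : encSize n = 2 * n + 1 := by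
  induction n with
  | zero => rfl
  | succ n ih =>
    change (Data.ofNat (n + 1)).size = _
    change (Data.ofNat n).size = _ at ih
    simp only [Data.ofNat, Data.size, ih]; omega

theorem encSize_bool_le (b : Bool) : encSize b ≤ 3 := by
  cases b
  · exact (by decide : 1 ≤ 3)
  · exact (by decide : 3 ≤ 3)

theorem encSize_append (l l' : List α) : encSize (l ++ l') + 1 = encSize l + encSize l' := by
  induction l with
  | nil => simp [encSize_nil]; omega
  | cons a l ih => simp only [List.cons_append, encSize_cons]; omega

theorem length_le_encSize (l : List α) : l.length ≤ encSize l := by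
  induction l with
  | nil => simp
  | cons a l ih => simp only [List.length_cons, encSize_cons]; omega

theorem encSize_le_of_forall (l : List α) (K : ℕ) (h : ∀ a ∈ l, encSize a ≤ K) :
    encSize l ≤ l.length * (K + 1) + 1 := by
  induction l with
  | nil => simp [encSize_nil]
  | cons a l ih =>
    have := h a (by simp)
    have := ih fun b hb => h b (by simp [hb])
    simp only [encSize_cons, List.length_cons, add_mul]; omega

theorem encSize_le_of_mem {l : List α} {a : α} (h : a ∈ l) : encSize a ≤ encSize l := by
  induction l with
  | nil => simp at h
  | cons b l ih =>
    simp only [encSize_cons]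
    rcases List.mem_cons.1 h with rfl | h
    · omega
    · have := ih h; omega

theorem PolyTime.encSize_le {f : α → β} (hf : PolyTime f) :
    ∃ T : Polynomial ℕ, ∀ a, encSize (f a) ≤ T.eval (encSize a) := by
  obtain ⟨p, T, h⟩ := hf
  refine ⟨T, fun a => ?_⟩
  obtain ⟨t, ht, htT⟩ := h a
  exact ht.size_le.trans htT

/-- A change of representation that does not affect the encoding costs nothing. -/
theorem PolyTime.of_enc_eq {f : α → β} (h : ∀ a, enc (f a) = enc a) : PolyTime f :=
  ⟨.id, .X, fun a => ⟨_, by rw [h]; exact .id _, by simp [encSize]⟩⟩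

@[fun_prop]
theorem PolyTime.id : PolyTime fun a : α => a := .of_enc_eq fun _ => rfl

@[fun_prop]
theorem PolyTime.const (b : β) : PolyTime fun _ : α => b := by
  suffices ∀ d : Data, ∃ (p : Prog) (T : Polynomial ℕ), ∀ x, ∃ t,
      p.Runs x d t ∧ t ≤ T.eval x.size by
    obtain ⟨p, T, h⟩ := this (enc b)
    exact ⟨p, T, fun a => h _⟩
  intro d
  induction d with
  | nil => exact ⟨.nil, .X, fun x => ⟨_, .nil x, by simp⟩⟩
  | cons a b iha ihb =>
    obtain ⟨p, T, hp⟩ := iha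
    obtain ⟨q, U, hq⟩ := ihb
    refine ⟨.pair p q, T + U + .X, fun x => ?_⟩
    obtain ⟨t, ht, htT⟩ := hp x
    obtain ⟨u, hu, huU⟩ := hq x
    refine ⟨_, .pair ht hu, ?_⟩
    simp only [Polynomial.eval_add, Polynomial.eval_X]
    omega

@[fun_prop]
theorem PolyTime.comp {g : β → γ} {f : α → β} (hg : PolyTime g) (hf : PolyTime f) :
    PolyTime fun x => g (f x) := by
  obtain ⟨p, T, hp⟩ := hf
  obtain ⟨q, U, hq⟩ := hg
  refine ⟨.comp q p, T + U.comp T + .X, fun x => ?_⟩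
  obtain ⟨t, ht, htT⟩ := hp x
  obtain ⟨u, hu, huU⟩ := hq (f x)
  refine ⟨_, .comp ht hu, ?_⟩
  have := eval_mono U (ht.size_le.trans htT)
  simp only [Polynomial.eval_add, Polynomial.eval_X, Polynomial.eval_comp]
  unfold encSize at *
  omega

@[fun_prop]
theorem PolyTime.prodMk {f : α → β} {g : α → γ} (hf : PolyTime f) (hg : PolyTime g) :
    PolyTime fun x => (f x, g x) := by
  obtain ⟨p, T, hp⟩ := hf
  obtain ⟨q, U, hq⟩ := hg
  refine ⟨.pair p q, T + U + .X, fun x => ?_⟩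
  obtain ⟨t, ht, htT⟩ := hp x
  obtain ⟨u, hu, huU⟩ := hq x
  refine ⟨_, .pair ht hu, ?_⟩
  simp only [Polynomial.eval_add, Polynomial.eval_X]
  unfold encSize at *
  omega

@[fun_prop]
theorem PolyTime.fst {f : α → β × γ} (hf : PolyTime f) : PolyTime fun x => (f x).1 :=
  PolyTime.comp (g := Prod.fst)
    ⟨.head, .X, fun x => ⟨_, .head_cons _ _, by simp [encSize, enc]⟩⟩ hf

@[fun_prop]
theorem PolyTime.snd {f : α → β × γ} (hf : PolyTime f) : PolyTime fun x => (f x).2 :=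
  PolyTime.comp (g := Prod.snd)
    ⟨.tail, .X, fun x => ⟨_, .tail_cons _ _, by simp [encSize, enc]⟩⟩ hf

/-- Case distinction on an encoding being `nil` or not. -/
theorem PolyTime.ite_of_enc {s : α → γ} {c : α → Prop} [DecidablePred c] {f g : α → β}
    (hs : PolyTime s) (hc : ∀ x, ¬ c x → enc (s x) = .nil)
    (hc' : ∀ x, c x → ∃ u v, enc (s x) = .cons u v) (hf : PolyTime f) (hg : PolyTime g) :
    PolyTime fun x => if c x then f x else g x := by
  obtain ⟨q, S, hq⟩ := hs
  obtain ⟨p₁, T₁, hp₁⟩ := hf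
  obtain ⟨p₂, T₂, hp₂⟩ := hg
  refine ⟨.ite q p₁ p₂, S + T₁ + T₂ + .X, fun x => ?_⟩
  obtain ⟨t, ht, htT⟩ := hq x
  obtain ⟨t₁, ht₁, htT₁⟩ := hp₁ x
  obtain ⟨t₂, ht₂, htT₂⟩ := hp₂ x
  simp only [Polynomial.eval_add, Polynomial.eval_X]
  by_cases h : c x
  · obtain ⟨u, v, huv⟩ := hc' x h
    rw [huv] at ht
    simp only [if_pos h]
    refine ⟨_, .ite_true ht ht₁, ?_⟩
    unfold encSize at *
    omega
  · rw [hc x h] at ht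
    simp only [if_neg h]
    refine ⟨_, .ite_false ht ht₂, ?_⟩
    unfold encSize at *
    omega

@[fun_prop]
theorem PolyTime.ite {c : α → Bool} {f g : α → β} (hc : PolyTime c) (hf : PolyTime f)
    (hg : PolyTime g) : PolyTime fun x => if c x = true then f x else g x :=
  .ite_of_enc hc (fun x h => by simp only [Bool.not_eq_true] at h; rw [h]; rfl)
    (fun x h => by rw [h]; exact ⟨_, _, rfl⟩) hf hg

@[fun_prop]
theorem PolyTime.and {f g : α → Bool} (hf : PolyTime f) (hg : PolyTime g) :
    PolyTime fun x => f x && g x := by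
  have : PolyTime fun x => if f x = true then g x else false := by fun_prop
  convert this using 2 with x
  cases f x <;> simp

@[fun_prop]
theorem PolyTime.or {f g : α → Bool} (hf : PolyTime f) (hg : PolyTime g) :
    PolyTime fun x => f x || g x := by
  have : PolyTime fun x => if f x = true then true else g x := by fun_prop
  convert this using 2 with x
  cases f x <;> simp

@[fun_prop]
theorem PolyTime.not {f : α → Bool} (hf : PolyTime f) : PolyTime fun x => !f x := by
  have : PolyTime fun x => if f x = true then false else true := by fun_prop
  convert this using 2 with x
  cases f x <;> simp

@[fun_prop]
theorem PolyTime.cons {f : α → β} {g : α → List β} (hf : PolyTime f) (hg : PolyTime g) :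
    PolyTime fun x => f x :: g x :=
  PolyTime.comp (f := fun x => (f x, g x)) (g := fun y : β × List β => y.1 :: y.2)
    (.of_enc_eq fun _ => rfl) (by fun_prop)

@[fun_prop]
theorem PolyTime.list_tail {f : α → List β} (hf : PolyTime f) : PolyTime fun x => (f x).tail :=
  PolyTime.comp (g := List.tail)
    ⟨.tail, .X, fun l => by
      cases l with
      | nil => exact ⟨_, .tail_nil, by simp [encSize, enc, Data.ofList]⟩
      | cons a l => exact ⟨_, .tail_cons _ _, by simp [encSize, enc, Data.ofList]⟩⟩ hf

@[fun_prop]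
theorem PolyTime.list_headD {f : α → List β} {d : α → β} (hf : PolyTime f) (hd : PolyTime d) :
    PolyTime fun x => (f x).headD (d x) := by
  obtain ⟨p, T, hp⟩ := hf
  obtain ⟨q, U, hq⟩ := hd
  refine ⟨.ite p (.comp .head p) q, 3 * T + U + 2 * .X, fun x => ?_⟩
  obtain ⟨t, ht, htT⟩ := hp x
  obtain ⟨u, hu, huU⟩ := hq x
  have hs := ht.size_le
  simp only [Polynomial.eval_add, Polynomial.eval_mul, Polynomial.eval_X, Polynomial.eval_ofNat]
  cases h : f x with
  | nil =>
    rw [h] at ht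
    refine ⟨_, .ite_false ht hu, ?_⟩
    unfold encSize at *
    omega
  | cons a l =>
    rw [h] at ht hs
    refine ⟨_, .ite_true ht (.comp ht (.head_cons _ _)), ?_⟩
    change (Data.cons (enc a) (Data.ofList (l.map enc))).size ≤ _ at hs
    unfold encSize at *
    omega

end Basic

section Fold

variable {α β γ : Type} [DataEncoding α] [DataEncoding β] [DataEncoding γ]

/-- Iteration over a list is polynomial-time as soon as all intermediate results have polynomial
size. -/
theorem PolyTime.foldl {l : γ → List α} {init : γ → β} {step : γ → β → α → β}
    (hl : PolyTime l) (hi : PolyTime init)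
    (hs : PolyTime fun y : γ × β × α => step y.1 y.2.1 y.2.2)
    (hb : ∃ B : Polynomial ℕ, ∀ x, ∀ l', l' <+: l x →
      encSize (l'.foldl (step x) (init x)) ≤ B.eval (encSize x)) :
    PolyTime fun x => (l x).foldl (step x) (init x) := by
  obtain ⟨B, hB⟩ := hb
  -- The loop works on triples of the argument, the accumulator and the rest of the list; its body
  -- is only executed if the latter is of the form `a :: l`.
  have hc : PolyTime fun y : γ × β × List α => y.2.2 := by fun_prop
  have hbody : PolyTime fun y : γ × β × α × List α =>
      (y.1, step y.1 y.2.1 y.2.2.1, y.2.2.2) := by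
    have : PolyTime fun y : γ × β × α × List α => step y.1 y.2.1 y.2.2.1 :=
      hs.comp (f := fun y : γ × β × α × List α => (y.1, y.2.1, y.2.2.1)) (by fun_prop)
    fun_prop
  obtain ⟨pc, Tc, hpc⟩ := hc
  obtain ⟨pb, Tb, hpb⟩ := hbody
  obtain ⟨L, hL⟩ := hl.encSize_le
  let state (x : γ) (l₁ l₂ : List α) : γ × β × List α := (x, l₁.foldl (step x) (init x), l₂)
  have key : PolyTime fun x => state x (l x) [] := by
    have hinit : PolyTime fun x => (x, init x, l x) := by fun_prop
    obtain ⟨pi, Ti, hpi⟩ := hinit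
    let S : Polynomial ℕ := .X + B + L + 2
    let K : Polynomial ℕ := Tc.comp S + Tb.comp S + S
    refine ⟨.comp (.loop pc pb) pi, Ti + (L + 1) * K + .X, fun x => ?_⟩
    have loop : ∀ l₂ l₁ : List α, l₁ ++ l₂ = l x → ∃ t,
        (Prog.loop pc pb).Runs (enc (state x l₁ l₂)) (enc (state x (l x) [])) t ∧
          t ≤ (l₂.length + 1) * K.eval (encSize x) := by
      intro l₂
      induction l₂ with
      | nil =>
        intro l₁ h
        rw [List.append_nil] at h
        subst h
        have hS : encSize (state x (l x) []) ≤ S.eval (encSize x) := by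
          have := hB x (l x) (List.prefix_refl _)
          have := one_le_encSize (l x)
          have := hL x
          simp only [S, state, encSize_prod, encSize_nil, Polynomial.eval_add, Polynomial.eval_X,
            Polynomial.eval_ofNat]
          omega
        obtain ⟨t, ht, htT⟩ := hpc (state x (l x) [])
        refine ⟨_, Prog.Runs.loop_stop ht, ?_⟩
        have h1 := eval_mono Tc hS
        simp only [K, Polynomial.eval_add, Polynomial.eval_comp]
        unfold encSize at *
        simp only [List.length_nil]
        omega
      | cons a l₂ ih =>
        intro l₁ h
        have hS : encSize (state x l₁ (a :: l₂)) ≤ S.eval (encSize x) := by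
          have h1 := hB x l₁ ⟨_, h⟩
          have h2 := hL x
          have h3 := encSize_append l₁ (a :: l₂)
          have h4 := one_le_encSize l₁
          rw [h] at h3
          simp only [S, state, encSize_prod, Polynomial.eval_add, Polynomial.eval_X,
            Polynomial.eval_ofNat]
          omega
        obtain ⟨t₁, ht₁, htT₁⟩ := hpc (state x l₁ (a :: l₂))
        obtain ⟨t₂, ht₂, htT₂⟩ := hpb (x, l₁.foldl (step x) (init x), a, l₂)
        obtain ⟨t₃, ht₃, htT₃⟩ := ih (l₁ ++ [a]) (by simpa using h)
        have heq : state x (l₁ ++ [a]) l₂ =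
            (x, step x (l₁.foldl (step x) (init x)) a, l₂) := by simp [state]
        rw [heq] at ht₃
        refine ⟨_, .loop_step ht₁ ht₂ ht₃, ?_⟩
        have h1 := htT₁.trans (eval_mono Tc hS)
        have h2 := htT₂.trans (eval_mono Tb hS)
        rw [List.length_cons, add_mul _ 1 (K.eval _), one_mul]
        have h3 : K.eval (encSize x) = Tc.eval (S.eval (encSize x)) + Tb.eval (S.eval (encSize x)) +
          S.eval (encSize x) := by simp [K]
        unfold encSize at *
        omega
    obtain ⟨t, ht, htT⟩ := hpi x
    obtain ⟨u, hu, huU⟩ := loop (l x) [] rfl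
    refine ⟨_, .comp ht hu, ?_⟩
    have h1 : (l x).length + 1 ≤ L.eval (encSize x) + 1 := by
      have := hL x
      have := length_le_encSize (l x)
      omega
    have h2 := huU.trans (Nat.mul_le_mul_right _ h1)
    simp only [Polynomial.eval_add, Polynomial.eval_mul, Polynomial.eval_X, Polynomial.eval_one]
    unfold encSize at *
    omega
  exact key.snd.fst

/-- Variant of `PolyTime.foldl` with a bound for the intermediate results that is not itself a
polynomial. -/
theorem PolyTime.foldl_of_bound {l : γ → List α} {init : γ → β} {step : γ → β → α → β}
    (B : γ → ℕ) (hB : ∃ T : Polynomial ℕ, ∀ x, B x ≤ T.eval (encSize x))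
    (hl : PolyTime l) (hi : PolyTime init)
    (hs : PolyTime fun y : γ × β × α => step y.1 y.2.1 y.2.2)
    (hb : ∀ x, ∀ l', l' <+: l x → encSize (l'.foldl (step x) (init x)) ≤ B x) :
    PolyTime fun x => (l x).foldl (step x) (init x) := by
  obtain ⟨T, hT⟩ := hB
  exact .foldl hl hi hs ⟨T, fun x l' h => (hb x l' h).trans (hT x)⟩

@[fun_prop]
theorem PolyTime.list_reverse {l : γ → List α} (hl : PolyTime l) :
    PolyTime fun x => (l x).reverse := by
  obtain ⟨L, hL⟩ := hl.encSize_le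
  have : PolyTime fun x => (l x).foldl (fun s a => a :: s) [] := by
    refine .foldl_of_bound (fun x => encSize (l x)) ⟨L, hL⟩ hl (by fun_prop) (by fun_prop) ?_
    intro x l' ⟨l'', h⟩
    rw [← h, List.foldl_flip_cons_eq_append', List.append_nil]
    have h1 := encSize_append l' l''
    have h2 := one_le_encSize l''
    have h3 : encSize l'.reverse = encSize l' := by
      clear h h1
      induction l' with
      | nil => rfl
      | cons a l ih =>
        have := encSize_append l.reverse [a]
        simp only [List.reverse_cons, encSize_cons, encSize_nil] at *
        omega
    omega
  convert this using 2 with x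
  simp

theorem PolyTime.list_map {l : γ → List α} {g : γ → α → β} (hl : PolyTime l)
    (hg : PolyTime fun y : γ × α => g y.1 y.2) : PolyTime fun x => (l x).map (g x) := by
  obtain ⟨L, hL⟩ := hl.encSize_le
  obtain ⟨G, hG⟩ := hg.encSize_le
  have hfold (x : γ) (l' : List α) :
      l'.foldl (fun s a => g x a :: s) [] = (l'.map (g x)).reverse := by
    simp
  have : PolyTime fun x => (l x).foldl (fun s a => g x a :: s) [] := by
    refine .foldl hl (by fun_prop) (PolyTime.cons
      (hg.comp (f := fun y : γ × List β × α => (y.1, y.2.2)) (by fun_prop)) (by fun_prop))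
      ⟨L * (G.comp (.X + L + 1) + 1) + 1, fun x l' h => ?_⟩
    rw [hfold]
    refine (encSize_le_of_forall _ (G.eval (encSize x + L.eval (encSize x) + 1)) ?_).trans ?_
    · simp only [List.mem_reverse, List.mem_map, forall_exists_index, and_imp,
        forall_apply_eq_imp_iff₂]
      intro a ha
      refine (hG (x, a)).trans (eval_mono G ?_)
      have := encSize_le_of_mem (h.subset ha)
      have := hL x
      simp only [encSize_prod]
      omega
    · simp only [List.length_reverse, List.length_map, Polynomial.eval_add, Polynomial.eval_mul,
        Polynomial.eval_comp, Polynomial.eval_X, Polynomial.eval_one]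
      gcongr
      exact h.length_le.trans ((length_le_encSize _).trans (hL x))
  convert this.list_reverse using 2 with x
  simp [hfold]

theorem PolyTime.list_any {l : γ → List α} {p : γ → α → Bool} (hl : PolyTime l)
    (hp : PolyTime fun y : γ × α => p y.1 y.2) : PolyTime fun x => (l x).any (p x) := by
  have : PolyTime fun x => (l x).foldl (fun s a => s || p x a) false :=
    .foldl hl (by fun_prop)
      (.or (by fun_prop) (hp.comp (f := fun y : γ × Bool × α => (y.1, y.2.2)) (by fun_prop)))
      ⟨3, fun x l' h => by simpa using encSize_bool_le _⟩
  convert this using 2 with x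
  suffices ∀ (l : List α) b, l.foldl (fun s a => s || p x a) b = (b || l.any (p x)) by
    simp [this]
  intro l
  induction l with
  | nil => simp
  | cons a l ih => intro b; simp [ih, Bool.or_assoc]

theorem PolyTime.list_all {l : γ → List α} {p : γ → α → Bool} (hl : PolyTime l)
    (hp : PolyTime fun y : γ × α => p y.1 y.2) : PolyTime fun x => (l x).all (p x) := by
  simpa only [← List.all_eq_not_any_not] using
    (PolyTime.list_any (p := fun x a => !p x a) hl hp.not).not

end Fold

theorem foldl_replicate {β : Type*} (step : β → β) (n : ℕ) (b : β) :
    (List.replicate n ()).foldl (fun s _ => step s) b = step^[n] b := by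
  induction n generalizing b with
  | zero => rfl
  | succ n ih => simp [List.replicate_succ, ih]

section Arithmetic

variable {α β γ : Type} [DataEncoding α] [DataEncoding β] [DataEncoding γ]

theorem PolyTime.replicate {f : γ → ℕ} (hf : PolyTime f) :
    PolyTime fun x => List.replicate (f x) () :=
  PolyTime.comp (g := fun n : ℕ => List.replicate n ()) (.of_enc_eq fun n => by
    induction n with
    | zero => rfl
    | succ n ih => exact congrArg (Data.cons .nil) ih) hf

/-- Iterating a function a given number of times. -/
theorem PolyTime.iterate {n : γ → ℕ} {init : γ → β} {step : γ → β → β} (hn : PolyTime n)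
    (hi : PolyTime init) (hs : PolyTime fun y : γ × β => step y.1 y.2)
    (hb : ∃ B : Polynomial ℕ, ∀ x, ∀ i ≤ n x,
      encSize ((step x)^[i] (init x)) ≤ B.eval (encSize x)) :
    PolyTime fun x => (step x)^[n x] (init x) := by
  obtain ⟨B, hB⟩ := hb
  have : PolyTime fun x => (List.replicate (n x) ()).foldl (fun s _ => step x s) (init x) := by
    refine .foldl (.replicate hn) hi
      (hs.comp (f := fun y : γ × β × Unit => (y.1, y.2.1)) (by fun_prop)) ⟨B, fun x l' h => ?_⟩
    obtain ⟨h1, h2⟩ := List.prefix_replicate_iff.1 h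
    rw [h2, foldl_replicate]
    exact hB x _ h1
  simpa only [foldl_replicate] using this

@[fun_prop]
theorem PolyTime.succ {f : γ → ℕ} (hf : PolyTime f) : PolyTime fun x => (f x).succ :=
  PolyTime.comp (f := fun x => ((), f x)) (g := fun y : Unit × ℕ => y.2.succ)
    (.of_enc_eq fun _ => rfl) (by fun_prop)

@[fun_prop]
theorem PolyTime.pred {f : γ → ℕ} (hf : PolyTime f) : PolyTime fun x => (f x).pred :=
  PolyTime.comp (g := Nat.pred)
    ⟨.tail, .X, fun n => by
      cases n with
      | zero => exact ⟨_, .tail_nil, by simp [encSize, enc, Data.ofNat]⟩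
      | succ n => exact ⟨_, .tail_cons _ _, by simp [encSize, enc, Data.ofNat]⟩⟩ hf

@[fun_prop]
theorem PolyTime.add {f g : γ → ℕ} (hf : PolyTime f) (hg : PolyTime g) :
    PolyTime fun x => f x + g x := by
  obtain ⟨F, hF⟩ := hf.encSize_le
  obtain ⟨G, hG⟩ := hg.encSize_le
  have : PolyTime fun x => Nat.succ^[g x] (f x) := by
    refine .iterate hg hf (by fun_prop) ⟨F + G, fun x i h => ?_⟩
    have h1 := hF x
    have h2 := hG x
    simp only [Nat.succ_iterate, encSize_nat, Polynomial.eval_add] at *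
    omega
  simpa only [Nat.succ_iterate] using this

@[fun_prop]
theorem PolyTime.sub {f g : γ → ℕ} (hf : PolyTime f) (hg : PolyTime g) :
    PolyTime fun x => f x - g x := by
  obtain ⟨F, hF⟩ := hf.encSize_le
  have : PolyTime fun x => Nat.pred^[g x] (f x) := by
    refine .iterate hg hf (by fun_prop) ⟨F, fun x i h => ?_⟩
    have h1 := hF x
    simp only [Nat.pred_iterate, encSize_nat] at *
    omega
  simpa only [Nat.pred_iterate] using this

@[fun_prop]
theorem PolyTime.mul {f g : γ → ℕ} (hf : PolyTime f) (hg : PolyTime g) :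
    PolyTime fun x => f x * g x := by
  obtain ⟨F, hF⟩ := hf.encSize_le
  obtain ⟨G, hG⟩ := hg.encSize_le
  have hiter (a i : ℕ) : (fun s => s + a)^[i] 0 = a * i := by simp [mul_comm]
  have : PolyTime fun x => (fun s => s + f x)^[g x] 0 := by
    refine .iterate hg (by fun_prop) (by fun_prop) ⟨2 * (F * G) + 1, fun x i h => ?_⟩
    have h1 := hF x
    have h2 := hG x
    simp only [encSize_nat, Polynomial.eval_add, Polynomial.eval_mul, Polynomial.eval_ofNat,
      Polynomial.eval_one, hiter] at *
    gcongr <;> omega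
  simpa only [hiter] using this

@[fun_prop]
theorem PolyTime.pow_const {f : γ → ℕ} (hf : PolyTime f) (k : ℕ) :
    PolyTime fun x => f x ^ k := by
  induction k with
  | zero => simp only [pow_zero]; fun_prop
  | succ k ih => simp only [pow_succ]; fun_prop

@[fun_prop]
theorem PolyTime.decide_le {f g : γ → ℕ} (hf : PolyTime f) (hg : PolyTime g) :
    PolyTime fun x => decide (f x ≤ g x) := by
  have : PolyTime fun x => if f x - g x ≠ 0 then false else true :=
    .ite_of_enc (s := fun x => f x - g x) (by fun_prop) (fun x h => by
      rw [not_not] at h; rw [h]; rfl) (fun x h => by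
      obtain ⟨n, hn⟩ := Nat.exists_eq_succ_of_ne_zero h
      rw [hn]; exact ⟨_, _, rfl⟩) (by fun_prop) (by fun_prop)
  convert this using 2 with x
  by_cases h : f x ≤ g x <;> simp [h, Nat.sub_eq_zero_iff_le]

@[fun_prop]
theorem PolyTime.decide_lt {f g : γ → ℕ} (hf : PolyTime f) (hg : PolyTime g) :
    PolyTime fun x => decide (f x < g x) :=
  .decide_le (f := fun x => (f x).succ) (by fun_prop) hg

@[fun_prop]
theorem PolyTime.beq {f g : γ → ℕ} (hf : PolyTime f) (hg : PolyTime g) :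
    PolyTime fun x => f x == g x := by
  have : PolyTime fun x => decide (f x ≤ g x) && decide (g x ≤ f x) := by fun_prop
  convert this using 2 with x
  rcases lt_trichotomy (f x) (g x) with h | h | h
  · simp [h.ne, h.not_ge]
  · simp [h]
  · simp [h.ne', h.not_ge]

@[fun_prop]
theorem PolyTime.length {l : γ → List α} (hl : PolyTime l) : PolyTime fun x => (l x).length := by
  have h1 := PolyTime.list_map (g := fun _ _ => ()) hl (by fun_prop)
  have h2 : PolyTime fun l : List Unit => l.length := .of_enc_eq fun l => by
    induction l with
    | nil => rfl
    | cons a l ih => exact congrArg (Data.cons .nil) ih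
  simpa using h2.comp h1

theorem PolyTime.range {f : γ → ℕ} (hf : PolyTime f) : PolyTime fun x => List.range (f x) := by
  obtain ⟨F, hF⟩ := hf.encSize_le
  have hiter (n : ℕ) : (fun s : List ℕ => s.length :: s)^[n] [] = (List.range n).reverse := by
    induction n with
    | zero => rfl
    | succ n ih => rw [Function.iterate_succ_apply', ih, List.range_succ]; simp
  have : PolyTime fun x => (fun s : List ℕ => s.length :: s)^[f x] [] := by
    refine .iterate hf (by fun_prop) (by fun_prop) ⟨F * (F + 1) + 1, fun x i h => ?_⟩
    have h1 := hF x
    rw [encSize_nat] at h1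
    rw [hiter]
    refine (encSize_le_of_forall _ (F.eval (encSize x)) fun a ha => ?_).trans ?_
    · simp only [List.mem_reverse, List.mem_range] at ha
      rw [encSize_nat]
      omega
    · simp only [List.length_reverse, List.length_range, Polynomial.eval_add, Polynomial.eval_mul,
        Polynomial.eval_one]
      gcongr
      omega
  simpa [hiter] using this.list_reverse

@[fun_prop]
theorem PolyTime.list_drop {l : γ → List α} {f : γ → ℕ} (hl : PolyTime l) (hf : PolyTime f) :
    PolyTime fun x => (l x).drop (f x) := by
  obtain ⟨L, hL⟩ := hl.encSize_le
  have hiter (n : ℕ) (l : List α) : List.tail^[n] l = l.drop n := by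
    induction n generalizing l with
    | zero => rfl
    | succ n ih => rw [Function.iterate_succ_apply, ih]; simp
  have : PolyTime fun x => List.tail^[f x] (l x) := by
    refine .iterate hf hl (by fun_prop) ⟨L, fun x i h => ?_⟩
    rw [hiter]
    have h1 := encSize_append ((l x).take i) ((l x).drop i)
    have h2 := one_le_encSize ((l x).take i)
    have h3 := hL x
    rw [List.take_append_drop] at h1
    omega
  simpa [hiter] using this

@[fun_prop]
theorem PolyTime.list_getD {l : γ → List α} {f : γ → ℕ} {d : γ → α} (hl : PolyTime l)
    (hf : PolyTime f) (hd : PolyTime d) : PolyTime fun x => (l x).getD (f x) (d x) := by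
  have : PolyTime fun x => ((l x).drop (f x)).headD (d x) := by fun_prop
  convert this using 2 with x
  simp [List.headD_eq_head?_getD, List.getD_eq_getElem?_getD]

theorem PolyTime.countP {l : γ → List α} {p : γ → α → Bool} (hl : PolyTime l)
    (hp : PolyTime fun y : γ × α => p y.1 y.2) : PolyTime fun x => (l x).countP (p x) := by
  obtain ⟨L, hL⟩ := hl.encSize_le
  have hfold (x : γ) (l : List α) (n : ℕ) :
      l.foldl (fun s a => if p x a = true then s + 1 else s) n = n + l.countP (p x) := by
    induction l generalizing n with
    | nil => simp
    | cons a l ih => rw [List.foldl_cons, ih, List.countP_cons]; split_ifs <;> omega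
  have : PolyTime fun x => (l x).foldl (fun s a => if p x a = true then s + 1 else s) 0 := by
    refine .foldl hl (by fun_prop) (.ite (hp.comp (f := fun y : γ × ℕ × α => (y.1, y.2.2))
      (by fun_prop)) (by fun_prop) (by fun_prop)) ⟨2 * L + 1, fun x l' h => ?_⟩
    have h1 := hL x
    have h2 := length_le_encSize (l x)
    have h3 := h.length_le
    have h4 := List.countP_le_length (l := l') (p := p x)
    simp only [hfold, encSize_nat, Polynomial.eval_add, Polynomial.eval_mul, Polynomial.eval_ofNat,
      Polynomial.eval_one]
    omega
  simpa [hfold] using this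

end Arithmetic

/-! ### The reduction as a computation on lists and natural numbers -/

/-- The number with the binary digits `coins[i * j], …, coins[i * j + j - 1]`, the most significant
digit first. -/
def blockValue (coins : List Bool) (j i : ℕ) : ℕ :=
  (List.range j).foldl (fun v b => 2 * v + if coins.getD (i * j + b) false = true then 1 else 0) 0

/-- Random groups for `M` hyperedges, numbered from `0` to `2 ^ j - 1`: each hyperedge uses its own
block of `j` coins. -/
def groups (M j : ℕ) (coins : List Bool) : List ℕ :=
  (List.range M).map (blockValue coins j)

/-- `u` is one of the connectors `0, …, ℓ` and `v` is the vertex of a hyperedge whose group is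
`u` or `u - 1`. -/
def connects (ℓ : ℕ) (g : List ℕ) (u v : ℕ) : Bool :=
  decide (u ≤ ℓ) && (decide (ℓ < v) &&
    (g.getD (v - (ℓ + 1)) 0 == u || g.getD (v - (ℓ + 1)) 0 + 1 == u))

/-- Adjacency between the connectors `0, …, ℓ`, the hyperedge vertices
`ℓ + 1, …, ℓ + g.length` and, beyond them, the apex. -/
def adjacent (ℓ : ℕ) (g : List ℕ) (u v : ℕ) : Bool :=
  (connects ℓ g u v || connects ℓ g v u) ||
    ((decide (ℓ + 1 + g.length ≤ u) && decide (v < ℓ + 1 + g.length)) ||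
      (decide (ℓ + 1 + g.length ≤ v) && decide (u < ℓ + 1 + g.length)))

/-- Connectors have no colors, the vertex of a hyperedge has the elements of the hyperedge as its
colors, and the apex has all colors. -/
def hasColor (ℓ : ℕ) (E : List (List ℕ)) (v c : ℕ) : Bool :=
  decide (ℓ < v) &&
    (decide (ℓ + 1 + E.length ≤ v) || (E.getD (v - (ℓ + 1)) []).any fun e => e == c)

/-- The components of the encoding of an instance with `a` apex vertices. -/
def instanceCode (a ℓ N : ℕ) (g : List ℕ) (E : List (List ℕ)) :
    ℕ × ℕ × List (List Bool) × List (List Bool) × ℕ × ℕ × Unit :=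
  (ℓ + 1 + g.length + a, N,
    (List.range (ℓ + 1 + g.length + a)).map (fun u =>
      (List.range (ℓ + 1 + g.length + a)).map fun v => adjacent ℓ g u v),
    (List.range (ℓ + 1 + g.length + a)).map (fun u =>
      (List.range N).map fun c => hasColor ℓ E u c),
    0, ℓ, ())

/-- The number of colors on a list of vertices. -/
def countColors (ℓ N : ℕ) (E : List (List ℕ)) (w : List ℕ) : ℕ :=
  (List.range N).countP fun c => w.any fun v => hasColor ℓ E v c

/-- Every group contains a hyperedge. -/
def allGroupsHit (ℓ : ℕ) (g : List ℕ) : Bool :=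
  (List.range ℓ).all fun i => g.any fun y => y == i

/-! ### The reduction runs in polynomial time -/

section

variable {γ : Type} [DataEncoding γ]

/-- The largest power of two up to `N` is found by doubling at most `N` times. -/
theorem logPair_eq (N i : ℕ) :
    (fun s : ℕ × ℕ => if 2 * s.1 ≤ N then (2 * s.1, s.2 + 1) else s)^[i] (1, 0) =
      (2 ^ min i (Nat.log 2 N), min i (Nat.log 2 N)) := by
  induction i with
  | zero => simp
  | succ i ih =>
    rw [Function.iterate_succ_apply', ih]
    rcases lt_or_ge i (Nat.log 2 N) with h | h
    · rw [min_eq_left h.le, min_eq_left (Nat.succ_le_of_lt h)]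
      have h0 : N ≠ 0 := by rintro rfl; simp at h
      have : 2 * 2 ^ i ≤ N := by
        rw [← pow_succ']
        exact (Nat.pow_le_pow_right (by norm_num) h).trans (Nat.pow_log_le_self 2 h0)
      simp [this, pow_succ']
    · rw [min_eq_right h, min_eq_right (h.trans (Nat.le_succ _))]
      have : ¬ 2 * 2 ^ Nat.log 2 N ≤ N := by
        rw [← pow_succ', not_le]
        exact Nat.lt_pow_succ_log_self (by norm_num) N
      simp [this]

theorem PolyTime.logPair {f : γ → ℕ} (hf : PolyTime f) :
    PolyTime fun x => (2 ^ Nat.log 2 (f x), Nat.log 2 (f x)) := by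
  obtain ⟨F, hF⟩ := hf.encSize_le
  have hlog (n : ℕ) : Nat.log 2 n ≤ n := Nat.log_le_self 2 n
  have : PolyTime fun x =>
      (fun s : ℕ × ℕ => if decide (2 * s.1 ≤ f x) = true then (2 * s.1, s.2 + 1) else s)^[f x]
        (1, 0) := by
    refine .iterate hf (by fun_prop) (by fun_prop) ⟨2 * F + 10, fun x i h => ?_⟩
    have h1 := hF x
    have h2 : 2 ^ min i (Nat.log 2 (f x)) ≤ f x + 1 := by
      rcases eq_or_ne (f x) 0 with h0 | h0
      · simp [h0]
      · refine (Nat.pow_le_pow_right (by norm_num) (min_le_right _ _)).trans ?_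
        exact (Nat.pow_log_le_self 2 h0).trans (Nat.le_succ _)
    simp only [decide_eq_true_eq, logPair_eq, encSize_prod, encSize_nat, Polynomial.eval_add,
      Polynomial.eval_mul, Polynomial.eval_ofNat] at *
    omega
  simpa only [decide_eq_true_eq, logPair_eq, min_eq_right (hlog _)] using this

@[fun_prop]
theorem PolyTime.log {f : γ → ℕ} (hf : PolyTime f) : PolyTime fun x => Nat.log 2 (f x) :=
  hf.logPair.snd

@[fun_prop]
theorem PolyTime.pow_log {f : γ → ℕ} (hf : PolyTime f) : PolyTime fun x => 2 ^ Nat.log 2 (f x) :=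
  hf.logPair.fst

theorem foldl_bits_lt (f : ℕ → Bool) (j : ℕ) :
    (List.range j).foldl (fun v b => 2 * v + if f b = true then 1 else 0) 0 < 2 ^ j := by
  induction j with
  | zero => simp
  | succ j ih =>
    rw [List.range_succ, List.foldl_append, pow_succ]
    simp only [List.foldl_cons, List.foldl_nil]
    split_ifs <;> omega

theorem blockValue_lt (coins : List Bool) (j i : ℕ) : blockValue coins j i < 2 ^ j :=
  foldl_bits_lt _ j

theorem PolyTime.groups {M f : γ → ℕ} {coins : γ → List Bool} (hM : PolyTime M) (hf : PolyTime f)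
    (hc : PolyTime coins) : PolyTime fun x => groups (M x) (Nat.log 2 (f x)) (coins x) := by
  refine .list_map (.range hM) ?_
  obtain ⟨F, hF⟩ := hf.encSize_le
  have h1 : PolyTime fun y : γ × ℕ => List.range (Nat.log 2 (f y.1)) := .range (by fun_prop)
  refine .foldl h1 (by fun_prop) (by fun_prop) ⟨2 * F + 10, fun y l' h => ?_⟩
  obtain ⟨k, hk, rfl⟩ : ∃ k ≤ Nat.log 2 (f y.1), l' = List.range k := by
    refine ⟨l'.length, by simpa using h.length_le, ?_⟩
    rw [List.prefix_iff_eq_take] at h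
    rw [h, List.take_range]
    simp
  have h2 := foldl_bits_lt
    (fun b => (coins y.1).getD (y.2 * Nat.log 2 (f y.1) + b) false) k
  have h3 : 2 ^ k ≤ f y.1 + 1 := by
    rcases eq_or_ne (f y.1) 0 with h0 | h0
    · rw [h0] at hk; simp at hk; simp [hk]
    · refine (Nat.pow_le_pow_right (by norm_num) hk).trans ?_
      exact (Nat.pow_log_le_self 2 h0).trans (Nat.le_succ _)
  have h4 := (hF y.1).trans (eval_mono F (b := encSize y) (by
    change _ ≤ encSize (y.1, y.2); rw [encSize_prod]; omega))
  simp only [encSize_nat, Polynomial.eval_add, Polynomial.eval_mul, Polynomial.eval_ofNat] at *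
  omega

theorem PolyTime.adjacent {ℓ u v : γ → ℕ} {g : γ → List ℕ} (hℓ : PolyTime ℓ) (hg : PolyTime g)
    (hu : PolyTime u) (hv : PolyTime v) :
    PolyTime fun x => adjacent (ℓ x) (g x) (u x) (v x) := by
  unfold MinColorPath.adjacent connects
  fun_prop

theorem PolyTime.hasColor {ℓ v c : γ → ℕ} {E : γ → List (List ℕ)} (hℓ : PolyTime ℓ)
    (hE : PolyTime E) (hv : PolyTime v) (hc : PolyTime c) :
    PolyTime fun x => hasColor (ℓ x) (E x) (v x) (c x) := by
  unfold MinColorPath.hasColor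
  have : PolyTime fun x => ((E x).getD (v x - (ℓ x + 1)) []).any fun e => e == c x :=
    .list_any (by fun_prop) (by fun_prop)
  fun_prop

theorem PolyTime.instanceCode (a : ℕ) {ℓ N : γ → ℕ} {g : γ → List ℕ} {E : γ → List (List ℕ)}
    (hℓ : PolyTime ℓ) (hN : PolyTime N) (hg : PolyTime g) (hE : PolyTime E) :
    PolyTime fun x => instanceCode a (ℓ x) (N x) (g x) (E x) := by
  have h1 : PolyTime fun x => List.range (ℓ x + 1 + (g x).length + a) := .range (by fun_prop)
  have h2 : PolyTime fun x => List.range (N x) := .range hN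
  refine .prodMk (by fun_prop) (.prodMk hN (.prodMk ?_ (.prodMk ?_ (by fun_prop))))
  · exact .list_map h1 (.list_map (h1.comp (.fst .id))
      (.adjacent (by fun_prop) (by fun_prop) (by fun_prop) (by fun_prop)))
  · exact .list_map h1 (.list_map (h2.comp (.fst .id))
      (.hasColor (by fun_prop) (by fun_prop) (by fun_prop) (by fun_prop)))

theorem PolyTime.countColors {ℓ N : γ → ℕ} {E : γ → List (List ℕ)} {w : γ → List ℕ}
    (hℓ : PolyTime ℓ) (hN : PolyTime N) (hE : PolyTime E) (hw : PolyTime w) :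
    PolyTime fun x => countColors (ℓ x) (N x) (E x) (w x) :=
  .countP (.range hN) (.list_any (by fun_prop)
    (.hasColor (by fun_prop) (by fun_prop) (by fun_prop) (by fun_prop)))

theorem PolyTime.allGroupsHit {ℓ : γ → ℕ} {g : γ → List ℕ} (hℓ : PolyTime ℓ) (hg : PolyTime g) :
    PolyTime fun x => allGroupsHit (ℓ x) (g x) :=
  .list_all (.range hℓ) (.list_any (by fun_prop) (by fun_prop))

end

/-! ### The instances produced by the reduction -/

section

variable {a ℓ N : ℕ} {g : List ℕ} {E : List (List ℕ)}

theorem adjacent_symm (u v : ℕ) : adjacent ℓ g u v = adjacent ℓ g v u := by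
  rw [Bool.eq_iff_iff]
  simp only [adjacent, Bool.or_eq_true]
  tauto

theorem adjacent_self (u : ℕ) : adjacent ℓ g u u = false := by
  rw [Bool.eq_false_iff, Ne]
  simp only [adjacent, connects, Bool.or_eq_true, Bool.and_eq_true, decide_eq_true_eq]
  omega

theorem adjacent_connectors {u v : ℕ} (hu : u ≤ ℓ) (hv : v ≤ ℓ) : adjacent ℓ g u v = false := by
  rw [Bool.eq_false_iff, Ne]
  simp only [adjacent, connects, Bool.or_eq_true, Bool.and_eq_true, decide_eq_true_eq]
  omega

theorem adjacent_edges {u v : ℕ} (hu : ℓ < u) (hu' : u < ℓ + 1 + g.length) (hv : ℓ < v)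
    (hv' : v < ℓ + 1 + g.length) : adjacent ℓ g u v = false := by
  rw [Bool.eq_false_iff, Ne]
  simp only [adjacent, connects, Bool.or_eq_true, Bool.and_eq_true, decide_eq_true_eq]
  omega

theorem adjacent_connector_edge {u i : ℕ} (hu : u ≤ ℓ) (hi : i < g.length) :
    adjacent ℓ g u (ℓ + 1 + i) = true ↔ u = g.getD i 0 ∨ u = g.getD i 0 + 1 := by
  simp only [adjacent, connects, Bool.or_eq_true, Bool.and_eq_true, decide_eq_true_eq,
    beq_iff_eq, Nat.add_sub_cancel_left]
  omega

theorem getD_lt (hg : ∀ y ∈ g, y < ℓ) {i : ℕ} (hi : i < g.length) : g.getD i 0 < ℓ := by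
  rw [List.getD_eq_getElem _ _ hi]
  exact hg _ (List.getElem_mem hi)

/-- The Min-Color Path instance of a hypergraph on `N` vertices with the list `E` of hyperedges,
which are distributed over `ℓ` groups according to `g`: connectors `0, …, ℓ`, one vertex between
the connectors `i` and `i + 1` for every hyperedge in group `i`, and `a` apex vertices. -/
def reductionInstance (a ℓ N : ℕ) (g : List ℕ) (E : List (List ℕ)) : Instance where
  n := ℓ + 1 + g.length + a
  m := N
  G :=
    { Adj := fun u v => adjacent ℓ g u v = true
      symm := ⟨fun u v h => by rw [adjacent_symm]; exact h⟩
      loopless := ⟨fun u h => by simp [adjacent_self] at h⟩ }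
  σ := fun v => Finset.univ.filter fun c => hasColor ℓ E v c = true
  s := ⟨0, by omega⟩
  t := ⟨ℓ, by omega⟩

theorem mem_reductionInstance_color {v : Fin (reductionInstance a ℓ N g E).n} {c : Fin N} :
    c ∈ (reductionInstance a ℓ N g E).σ v ↔ hasColor ℓ E v c = true := by
  change c ∈ Finset.univ.filter _ ↔ _
  simp

theorem list_ofFn_eq_map_range {β : Type*} {n : ℕ} (F : Fin n → β) (f : ℕ → β)
    (h : ∀ i : Fin n, F i = f i) : List.ofFn F = (List.range n).map f := by
  apply List.ext_getElem <;> simp [h]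

open Classical in
theorem encode_reductionInstance :
    (reductionInstance a ℓ N g E).encode = enc (instanceCode a ℓ N g E) := by
  unfold Instance.encode
  refine congrArg₂ (fun x y => Data.ofList [Data.ofNat (ℓ + 1 + g.length + a), Data.ofNat N,
    Data.ofList x, Data.ofList y, Data.ofNat 0, Data.ofNat ℓ]) ?_ ?_
  · simp only [instanceCode, List.map_map]
    refine list_ofFn_eq_map_range _ _ fun u => congrArg Data.ofList ?_
    simp only [List.map_map]
    refine list_ofFn_eq_map_range _ _ fun v => congrArg Data.ofBool ?_
    rw [Bool.eq_iff_iff, decide_eq_true_eq]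
    exact Iff.rfl
  · simp only [instanceCode, List.map_map]
    refine list_ofFn_eq_map_range _ _ fun u => congrArg Data.ofList ?_
    simp only [List.map_map]
    refine list_ofFn_eq_map_range _ _ fun c => congrArg Data.ofBool ?_
    rw [Bool.eq_iff_iff, decide_eq_true_eq]
    exact mem_reductionInstance_color

/-- The set of colors on a walk. -/
def Instance.colors (I : Instance) {u v : Fin I.n} (w : I.G.Walk u v) : Finset (Fin I.m) :=
  w.support.toFinset.biUnion I.σ

theorem card_filter_eq_countP (p : ℕ → Bool) (n : ℕ) :
    (Finset.univ.filter fun c : Fin n => p c = true).card = (List.range n).countP p := by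
  rw [Fin.univ_def, ← List.map_coe_finRange_eq_range, List.countP_map, List.countP_eq_length_filter]
  simp only [Finset.filter, Finset.card, Multiset.filter_coe, Multiset.coe_card]
  congr 1
  exact List.filter_congr fun x _ => by simp

theorem countColors_support {u v : Fin (reductionInstance a ℓ N g E).n}
    (w : (reductionInstance a ℓ N g E).G.Walk u v) :
    countColors ℓ N E (w.support.map fun x : Fin (reductionInstance a ℓ N g E).n => x.val) =
      (reductionInstance a ℓ N g E).numColors w := by
  rw [countColors, ← card_filter_eq_countP, Instance.numColors]
  refine congrArg Finset.card (Finset.ext fun c => ?_)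
  refine Iff.trans ?_ Finset.mem_biUnion.symm
  simp only [List.any_map, List.any_eq_true, Finset.mem_filter, Finset.mem_univ, true_and,
    Function.comp_apply, List.mem_toFinset]
  exact exists_congr fun v => and_congr_right fun _ => mem_reductionInstance_color.symm

/-- A diamond path is given by connectors and middle vertices, each of which is assigned to one of
the `ℓ` edges of the path. -/
theorem isDiamondPath_of_equiv {V : Type*} (G : SimpleGraph V) {ℓ M : ℕ} (g : Fin M → Fin ℓ)
    (hg : Function.Surjective g) (e : Fin (ℓ + 1) ⊕ Fin M ≃ V)
    (h₁ : ∀ u v, ¬ G.Adj (e (.inl u)) (e (.inl v))) (h₂ : ∀ i j, ¬ G.Adj (e (.inr i)) (e (.inr j)))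
    (h₃ : ∀ u i, G.Adj (e (.inl u)) (e (.inr i)) ↔ u = (g i).castSucc ∨ u = (g i).succ) :
    IsDiamondPath G := by
  let f : Fin M ≃ Σ i : Fin ℓ, Fin (Fintype.card {x // g x = i}) :=
    (Equiv.sigmaFiberEquiv g).symm.trans (Equiv.sigmaCongrRight fun i => Fintype.equivFin _)
  have hf : ∀ x, (f x).1 = g x := fun x => rfl
  refine ⟨ℓ, fun i => Fintype.card {x // g x = i}, fun i => ?_, ⟨?_⟩⟩
  · obtain ⟨x, hx⟩ := hg i
    exact Fintype.card_pos_iff.2 ⟨⟨x, hx⟩⟩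
  · refine SimpleGraph.Iso.symm ⟨(Equiv.sumCongr (.refl _) f.symm).trans e, ?_⟩
    rintro (u | y) (v | z)
    · simp [diamondPath, h₁]
    · obtain ⟨z, rfl⟩ := f.surjective z
      simp [diamondPath, h₃, hf]
    · obtain ⟨y, rfl⟩ := f.surjective y
      rw [SimpleGraph.adj_comm]
      simp [diamondPath, h₃, hf]
    · simp [diamondPath, h₂]

/-- The graph of the reduction without apex, on a vertex type with an arbitrary numbering `f`. -/
theorem isDiamondPath_of_val {V : Type*} (G : SimpleGraph V) (f : V → ℕ)
    (hG : ∀ u v, G.Adj u v ↔ adjacent ℓ g (f u) (f v) = true)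
    (e : Fin (ℓ + 1 + g.length) ≃ V) (he : ∀ x, f (e x) = x)
    (hg : ∀ y ∈ g, y < ℓ) (hhit : allGroupsHit ℓ g = true) : IsDiamondPath G := by
  refine isDiamondPath_of_equiv G (fun i : Fin g.length => ⟨g.getD i 0, getD_lt hg i.2⟩) ?_
    (finSumFinEquiv.trans e) ?_ ?_ ?_
  · intro i
    simp only [allGroupsHit, List.all_eq_true, List.mem_range, List.any_eq_true, beq_iff_eq,
      exists_eq_right] at hhit
    obtain ⟨k, hk, hk'⟩ := List.getElem_of_mem (hhit i i.2)
    exact ⟨⟨k, hk⟩, Fin.ext ((List.getD_eq_getElem _ _ hk).trans hk')⟩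
  · intro u v
    have := u.2
    have := v.2
    simp [hG, he, adjacent_connectors, show (u : ℕ) ≤ ℓ by omega, show (v : ℕ) ≤ ℓ by omega]
  · intro i j
    have := i.2
    have := j.2
    simp only [Equiv.trans_apply, finSumFinEquiv_apply_right, hG, he, Fin.val_natAdd]
    rw [adjacent_edges] <;> first | omega | simp
  · intro u i
    have := u.2
    simp only [Equiv.trans_apply, finSumFinEquiv_apply_right, finSumFinEquiv_apply_left, hG, he,
      Fin.val_natAdd, Fin.val_castAdd]
    rw [adjacent_connector_edge (by omega) i.2]
    simp [Fin.ext_iff]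

theorem isDiamondPath_reductionInstance (hg : ∀ y ∈ g, y < ℓ) (hhit : allGroupsHit ℓ g = true) :
    IsDiamondPath (reductionInstance 0 ℓ N g E).G :=
  isDiamondPath_of_val _ (fun v => v.val) (fun _ _ => Iff.rfl) (Equiv.refl _) (fun _ => rfl) hg hhit

theorem isDiamondPath_reductionInstance_apex (hg : ∀ y ∈ g, y < ℓ)
    (hhit : allGroupsHit ℓ g = true) :
    ∃ v, IsDiamondPath ((reductionInstance 1 ℓ N g E).G.induce {v}ᶜ) := by
  refine ⟨Fin.last (ℓ + 1 + g.length), isDiamondPath_of_val _ (fun v => v.1.val)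
    (fun _ _ => Iff.rfl) (finSuccAboveEquiv (Fin.last (ℓ + 1 + g.length))) ?_ hg hhit⟩
  intro x
  change (Fin.succAbove (Fin.last (ℓ + 1 + g.length)) x).val = x.val
  rw [Fin.succAbove_last, Fin.val_castSucc]

/-- The apex has all colors and is adjacent to all other vertices. -/
theorem colorConnected_reductionInstance (hE : g.length = E.length) :
    (reductionInstance 1 ℓ N g E).ColorConnected := by
  intro c
  have hapex : hasColor ℓ E (ℓ + 1 + g.length) c = true := by
    simp [hasColor, hE]; omega
  let x : {v | c ∈ (reductionInstance 1 ℓ N g E).σ v} :=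
    ⟨⟨ℓ + 1 + g.length, Nat.lt_succ_self _⟩, mem_reductionInstance_color.2 hapex⟩
  rw [SimpleGraph.connected_iff_exists_forall_reachable]
  refine ⟨x, fun y => ?_⟩
  rcases eq_or_ne x y with rfl | hne
  · rfl
  · refine SimpleGraph.Adj.reachable ?_
    have h1 : y.1.val < ℓ + 1 + g.length := by
      have h2 : y.1.val < ℓ + 1 + g.length + 1 := y.1.2
      have h3 : y.1.val ≠ ℓ + 1 + g.length := fun h => hne (Subtype.ext (Fin.ext h.symm))
      omega
    change adjacent ℓ g (ℓ + 1 + g.length) y.1.val = true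
    simp [adjacent, h1]

/-- If some hyperedges inside `S` hit all groups, then they yield a path with colors in `S`. -/
theorem exists_path_of_hit (hE : g.length = E.length) (D : Set ℕ)
    (S : Finset (Fin N))
    (hD : ∀ i ∈ D, ∀ c : Fin N, (c : ℕ) ∈ E.getD i [] → c ∈ S)
    (hhit : ∀ k < ℓ, ∃ i ∈ D, i < g.length ∧ g.getD i 0 = k) :
    ∃ w : (reductionInstance a ℓ N g E).G.Walk (reductionInstance a ℓ N g E).s
        (reductionInstance a ℓ N g E).t,
      w.IsPath ∧ (reductionInstance a ℓ N g E).numColors w ≤ S.card := by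
  let I : Instance := reductionInstance a ℓ N g E
  let A : Set (Fin I.n) := {v | v.val ≤ ℓ ∨ ∃ i ∈ D, i < g.length ∧ v.val = ℓ + 1 + i}
  have hlt : ∀ k ≤ ℓ, k < I.n := fun k hk => by
    change k < ℓ + 1 + g.length + a; omega
  have hreach : ∀ k (hk : k ≤ ℓ), (I.G.induce A).Reachable
      ⟨⟨0, hlt 0 (Nat.zero_le _)⟩, .inl (Nat.zero_le _)⟩ ⟨⟨k, hlt k hk⟩, .inl hk⟩ := by
    intro k
    induction k with
    | zero => intro _; rfl
    | succ k ih =>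
      intro hk
      obtain ⟨i, hiD, hi, hik⟩ := hhit k hk
      have hn : ℓ + 1 + i < I.n := by
        change _ < ℓ + 1 + g.length + a; omega
      let y : A := ⟨⟨ℓ + 1 + i, hn⟩, .inr ⟨i, hiD, hi, rfl⟩⟩
      refine ((ih (by omega)).trans (SimpleGraph.Adj.reachable (v := y) ?_)).trans
        (SimpleGraph.Adj.reachable (SimpleGraph.Adj.symm ?_))
      · exact (adjacent_connector_edge (u := k) (by omega) hi).2 (.inl hik.symm)
      · exact (adjacent_connector_edge (u := k + 1) hk hi).2 (.inr (by rw [hik]))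
  obtain ⟨w, hw⟩ := (hreach ℓ le_rfl).exists_isPath
  refine ⟨w.map (SimpleGraph.Embedding.induce A).toHom,
    hw.map Subtype.val_injective, ?_⟩
  refine Finset.card_le_card fun c hc => ?_
  obtain ⟨v, hv, hc⟩ := Finset.mem_biUnion.1 hc
  have hsupp := SimpleGraph.Walk.support_map (SimpleGraph.Embedding.induce A).toHom w
  obtain ⟨y, -, rfl⟩ := List.mem_map.1 (hsupp ▸ List.mem_toFinset.1 hv)
  replace hc : hasColor ℓ E y.1.val c.val = true := mem_reductionInstance_color.1 hc
  simp only [hasColor, Bool.and_eq_true, Bool.or_eq_true, decide_eq_true_eq, List.any_eq_true,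
    beq_iff_eq, exists_eq_right] at hc
  rcases y.2 with h | ⟨i, hiD, hi, hy⟩
  · omega
  · rw [hy, Nat.add_sub_cancel_left] at hc
    rcases hc.2 with h | h
    · omega
    · exact hD i hiD c h

/-- A path from the first to the last connector either contains the apex, or it contains a
hyperedge of every group. -/
theorem exists_edges_of_walk (hE : g.length = E.length)
    (w : (reductionInstance a ℓ N g E).G.Walk (reductionInstance a ℓ N g E).s
        (reductionInstance a ℓ N g E).t) :
    N ≤ (reductionInstance a ℓ N g E).numColors w ∨
    ∃ f : Fin ℓ → ℕ, ∀ k, f k < g.length ∧ g.getD (f k) 0 = k ∧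
      ∀ c : Fin N, (c : ℕ) ∈ E.getD (f k) [] → c ∈ (reductionInstance a ℓ N g E).colors w := by
  let I : Instance := reductionInstance a ℓ N g E
  have hcol : ∀ v ∈ w.support, ∀ c : Fin N, hasColor ℓ E v c = true → c ∈ I.colors w := by
    intro v hv c hc
    exact Finset.mem_biUnion.2 ⟨v, List.mem_toFinset.2 hv, mem_reductionInstance_color.2 hc⟩
  by_cases hap : ∃ v ∈ w.support, ℓ + 1 + g.length ≤ v.val
  · left
    obtain ⟨v, hv, hv'⟩ := hap
    have : I.colors w = Finset.univ := by
      refine Finset.eq_univ_iff_forall.2 fun c => hcol v hv c ?_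
      simp only [hasColor, Bool.and_eq_true, Bool.or_eq_true, decide_eq_true_eq]
      omega
    change N ≤ (I.colors w).card
    rw [this, Finset.card_univ]
    exact (Fintype.card_fin N).ge
  · right
    push Not at hap
    suffices ∀ k : Fin ℓ, ∃ i, i < g.length ∧ g.getD i 0 = k ∧
        ∀ c : Fin N, (c : ℕ) ∈ E.getD i [] → c ∈ I.colors w by
      choose f hf using this
      exact ⟨f, hf⟩
    intro k
    -- Look at the edge along which the walk leaves the part to the left of group `k`.
    let A : Set (Fin I.n) := {v | v.val ≤ k ∨ ℓ < v.val ∧ g.getD (v.val - (ℓ + 1)) 0 < k}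
    obtain ⟨d, hd, hd1, hd2⟩ := w.exists_boundary_dart A (.inl (Nat.zero_le _)) (by
      have := k.2
      change ¬ (ℓ ≤ (k : ℕ) ∨ ℓ < ℓ ∧ _)
      omega)
    have hd1' := hap _ (w.dart_fst_mem_support_of_mem_darts hd)
    have hmem := w.dart_snd_mem_support_of_mem_darts hd
    have hd2' := hap _ hmem
    have hadj : adjacent ℓ g d.fst.val d.snd.val = true := d.adj
    simp only [adjacent, connects, Bool.or_eq_true, Bool.and_eq_true, decide_eq_true_eq,
      beq_iff_eq] at hadj
    replace hd1 : d.fst.val ≤ k ∨ ℓ < d.fst.val ∧ g.getD (d.fst.val - (ℓ + 1)) 0 < k := hd1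
    replace hd2 : ¬ (d.snd.val ≤ k ∨ ℓ < d.snd.val ∧ g.getD (d.snd.val - (ℓ + 1)) 0 < k) := hd2
    have hk := k.2
    refine ⟨d.snd.val - (ℓ + 1), by omega, by omega, fun c hc => hcol _ hmem c ?_⟩
    simp only [hasColor, Bool.and_eq_true, Bool.or_eq_true, decide_eq_true_eq, List.any_eq_true,
      beq_iff_eq, exists_eq_right]
    exact ⟨by omega, .inr hc⟩

end

/-! ### The list of hyperedges -/

section

variable {n r : ℕ} {H : Finset (Finset (Fin n))}

/-- The hyperedges of `H` in the order in which they are encoded. -/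
def edgeList (n r : ℕ) (H : Finset (Finset (Fin n))) : List (List (Fin n)) :=
  ((List.finRange n).sublistsLen r).filter fun e => e.toFinset ∈ H

/-- The hyperedges of `H` as lists of natural numbers. -/
def edgeCode (n r : ℕ) (H : Finset (Finset (Fin n))) : List (List ℕ) :=
  (edgeList n r H).map fun e => e.map fun v => v.val

/-- The coercion of a list to a list of natural numbers, as it is elaborated in
`encodeHypergraph` and `Instance.encodeWalk`. -/
theorem list_bind_coe_eq_map (l : List (Fin n)) :
    (do let a ← l; pure (a : ℕ)) = l.map fun v => v.val :=
  List.flatMap_pure_eq_map _ _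

theorem encodeHypergraph_eq : encodeHypergraph n r H = enc (n, edgeCode n r H) := by
  simp only [encodeHypergraph, edgeCode, edgeList, enc, List.map_map, list_bind_coe_eq_map,
    Function.comp_def]

theorem nodup_edgeList : ((edgeList n r H).map List.toFinset).Nodup := by
  refine List.Nodup.map_on ?_ ((List.nodup_sublistsLen r (List.nodup_finRange n)).filter _)
  intro x hx y hy h
  have hx' := (List.mem_sublistsLen.1 (List.mem_filter.1 hx).1).1
  have hy' := (List.mem_sublistsLen.1 (List.mem_filter.1 hy).1).1
  have hsorted := List.sortedLT_finRange n
  exact (List.perm_of_nodup_nodup_toFinset_eq (hx'.nodup (List.nodup_finRange n))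
    (hy'.nodup (List.nodup_finRange n)) h).eq_of_sortedLE
    (hsorted.pairwise.sublist hx').sortedLT.sortedLE
    (hsorted.pairwise.sublist hy').sortedLT.sortedLE

theorem toFinset_mem_of_mem_edgeList {e : List (Fin n)} (he : e ∈ edgeList n r H) :
    e.toFinset ∈ H := by
  simpa using (List.mem_filter.1 he).2

theorem exists_mem_edgeList (hH : H ∈ uniformHypergraphs n r) {e : Finset (Fin n)} (he : e ∈ H) :
    ∃ l ∈ edgeList n r H, l.toFinset = e := by
  have hcard : e.card = r := by
    have := Finset.mem_powerset.1 hH he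
    exact (Finset.mem_powersetCard.1 this).2
  refine ⟨e.sort (· ≤ ·), List.mem_filter.2 ⟨List.mem_sublistsLen.2 ⟨?_, by simp [hcard]⟩,
    by simpa⟩, by simp⟩
  exact List.sublist_of_subperm_of_sortedLE
    ((e.sort_nodup _).subperm fun x _ => List.mem_finRange x) e.sortedLT_sort.sortedLE
    (List.sortedLT_finRange n).sortedLE

theorem length_edgeList (hH : H ∈ uniformHypergraphs n r) : (edgeList n r H).length = H.card := by
  rw [← List.length_map (as := edgeList n r H) List.toFinset,
    ← List.toFinset_card_of_nodup nodup_edgeList]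
  congr 1
  ext e
  simp only [List.mem_toFinset, List.mem_map]
  constructor
  · rintro ⟨l, hl, rfl⟩
    exact toFinset_mem_of_mem_edgeList hl
  · exact exists_mem_edgeList hH

theorem length_edgeCode (hH : H ∈ uniformHypergraphs n r) : (edgeCode n r H).length = H.card := by
  rw [edgeCode, List.length_map, length_edgeList hH]

end

/-! ### Random groups -/

section

/-- Restricting random bits along an injection yields random bits. -/
theorem card_filter_comp_mul {A B : Type*} [Fintype A] [Fintype B] [DecidableEq A] [DecidableEq B]
    (f : A → B) (hf : Function.Injective f) (Q : (A → Bool) → Prop) [DecidablePred Q] :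
    (Finset.univ.filter fun ω : B → Bool => Q (ω ∘ f)).card * 2 ^ Fintype.card A =
      (Finset.univ.filter Q).card * 2 ^ Fintype.card B := by
  classical
  let e : (B → Bool) ≃ (A → Bool) × ({b // b ∉ Set.range f} → Bool) :=
    (Equiv.piEquivPiSubtypeProd (fun b => b ∈ Set.range f) fun _ => Bool).trans
      (Equiv.prodCongr (Equiv.arrowCongr (Equiv.ofInjective f hf).symm (.refl _)) (.refl _))
  have he : ∀ ω, (e ω).1 = ω ∘ f := fun ω => by
    ext a; simp [e, Equiv.piEquivPiSubtypeProd]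
  have h1 : (Finset.univ.filter fun ω : B → Bool => Q (ω ∘ f)).card =
      ((Finset.univ.filter Q) ×ˢ (Finset.univ : Finset ({b // b ∉ Set.range f} → Bool))).card := by
    refine Finset.card_equiv e fun ω => ?_
    simp [he]
  have h2 := Fintype.card_congr e
  simp only [Fintype.card_prod, Fintype.card_fun, Fintype.card_bool] at h2
  rw [h1, Finset.card_product, h2, Finset.card_univ, Fintype.card_fun, Fintype.card_bool]
  ring

/-- The number with a given sequence of binary digits. -/
def bitsValue {j : ℕ} (x : Fin j → Bool) : ℕ := blockValue (List.ofFn x) j 0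

theorem foldl_bits_injOn (j : ℕ) (f f' : ℕ → Bool)
    (h : (List.range j).foldl (fun v b => 2 * v + if f b = true then 1 else 0) 0 =
      (List.range j).foldl (fun v b => 2 * v + if f' b = true then 1 else 0) 0) :
    ∀ b < j, f b = f' b := by
  induction j with
  | zero => simp
  | succ j ih =>
    rw [List.range_succ, List.foldl_append, List.foldl_append] at h
    simp only [List.foldl_cons, List.foldl_nil] at h
    have h1 : f j = f' j := by
      rcases h2 : f j with _ | _ <;> rcases h3 : f' j with _ | _ <;> simp [h2, h3] at h ⊢ <;> omega
    rw [h1] at h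
    intro b hb
    rcases Nat.lt_succ_iff_lt_or_eq.1 hb with hb | rfl
    · exact ih (by omega) b hb
    · exact h1

theorem bitsValue_injective (j : ℕ) : Function.Injective (bitsValue (j := j)) := by
  intro x y h
  ext b
  have := foldl_bits_injOn j _ _ h b b.2
  simpa using congrArg (· = true) this

theorem exists_bitsValue_eq {j k : ℕ} (hk : k < 2 ^ j) : ∃ x : Fin j → Bool, bitsValue x = k := by
  let f : (Fin j → Bool) → Fin (2 ^ j) := fun x => ⟨bitsValue x, blockValue_lt _ _ _⟩
  have hf : Function.Bijective f := by
    rw [Fintype.bijective_iff_injective_and_card]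
    exact ⟨fun x y h => bitsValue_injective j (congrArg Fin.val h), by simp⟩
  obtain ⟨x, hx⟩ := hf.2 ⟨k, hk⟩
  exact ⟨x, congrArg Fin.val hx⟩

theorem blockValue_ofFn {L j M : ℕ} (hL : M * j ≤ L) (ω : Fin L → Bool) (i : Fin M) :
    blockValue (List.ofFn ω) j i = bitsValue fun b : Fin j => ω ⟨i * j + b, by
      have := i.2; have := b.2
      calc (i : ℕ) * j + b < i * j + j := by omega
        _ = (i + 1) * j := by ring
        _ ≤ M * j := Nat.mul_le_mul_right _ i.2
        _ ≤ L := hL⟩ := by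
  unfold bitsValue blockValue
  refine List.foldl_ext _ _ _ fun v b hb => ?_
  rw [List.mem_range] at hb
  have hlt : (i : ℕ) * j + b < L := by
    calc (i : ℕ) * j + b < i * j + j := by omega
      _ = (i + 1) * j := by ring
      _ ≤ M * j := Nat.mul_le_mul_right _ i.2
      _ ≤ L := hL
  simp [hlt, hb]

open Classical in
/-- The probability that a given group contains none of the hyperedges in `D`. -/
theorem card_missed {L j M : ℕ} (hL : M * j ≤ L) (D : Finset (Fin M)) {k : ℕ} (hk : k < 2 ^ j) :
    ((Finset.univ.filter fun ω : Fin L → Bool =>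
      ∀ i ∈ D, blockValue (List.ofFn ω) j i ≠ k).card : ℝ) / 2 ^ L =
      (1 - 1 / 2 ^ j) ^ D.card := by
  obtain ⟨x, rfl⟩ := exists_bitsValue_eq hk
  have hlt : ∀ y : Fin M × Fin j, (y.1 : ℕ) * j + y.2 < L := fun y => by
    calc (y.1 : ℕ) * j + y.2 < y.1 * j + j := by have := y.2.2; omega
      _ = (y.1 + 1) * j := by ring
      _ ≤ M * j := Nat.mul_le_mul_right _ y.1.2
      _ ≤ L := hL
  let f : Fin M × Fin j → Fin L := fun y => ⟨y.1 * j + y.2, hlt y⟩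
  have hf : Function.Injective f := by
    rintro ⟨i, b⟩ ⟨i', b'⟩ h
    have h1 : (i : ℕ) * j + b = i' * j + b' := congrArg Fin.val h
    have hb := b.2
    have hb' := b'.2
    have h2 : (i : ℕ) = i' := by
      have e1 : ((i : ℕ) * j + b) / j = i := by
        rw [mul_comm, Nat.mul_add_div (by omega), Nat.div_eq_of_lt hb, add_zero]
      have e2 : ((i' : ℕ) * j + b') / j = i' := by
        rw [mul_comm, Nat.mul_add_div (by omega), Nat.div_eq_of_lt hb', add_zero]
      rw [← e1, ← e2, h1]
    rw [h2] at h1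
    exact Prod.ext (Fin.ext h2) (Fin.ext (Nat.add_left_cancel h1))
  have h1 := card_filter_comp_mul f hf fun η => ∀ i ∈ D, (fun b => η (i, b)) ≠ x
  have h2 : (Finset.univ.filter fun η : Fin M × Fin j → Bool =>
      ∀ i ∈ D, (fun b => η (i, b)) ≠ x).card = (2 ^ j - 1) ^ D.card * (2 ^ j) ^ (M - D.card) := by
    have : (Finset.univ.filter fun η : Fin M × Fin j → Bool =>
        ∀ i ∈ D, (fun b => η (i, b)) ≠ x).card =
        (Fintype.piFinset fun i : Fin M =>
          if i ∈ D then Finset.univ.erase x else Finset.univ).card := by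
      refine Finset.card_equiv (Equiv.curry _ _ _) fun η => ?_
      simp only [Finset.mem_filter, Finset.mem_univ, true_and, Fintype.mem_piFinset]
      refine forall_congr' fun i => ?_
      by_cases hi : i ∈ D
      · simp only [hi, if_true, Finset.mem_erase, Finset.mem_univ, and_true, true_imp_iff]
        exact Iff.rfl
      · simp [hi]
    rw [this, Fintype.card_piFinset]
    have : ∀ i : Fin M, (if i ∈ D then Finset.univ.erase x else Finset.univ).card =
        if i ∈ D then 2 ^ j - 1 else 2 ^ j := by
      intro i
      split_ifs <;> simp
    simp only [this, Finset.prod_ite, Finset.prod_const]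
    congr 2
    · simp
    · rw [Finset.filter_not, Finset.card_sdiff_of_subset (Finset.filter_subset _ _)]
      simp
  have hD : D.card ≤ M := by simpa using D.card_le_univ
  have h3 : (Finset.univ.filter fun ω : Fin L → Bool =>
      ∀ i ∈ D, blockValue (List.ofFn ω) j i ≠ bitsValue x).card =
      (Finset.univ.filter fun ω : Fin L → Bool =>
        ∀ i ∈ D, (fun b => (ω ∘ f) (i, b)) ≠ x).card := by
    congr 1
    ext ω
    simp only [Finset.mem_filter, Finset.mem_univ, true_and]
    refine forall₂_congr fun i _ => ?_
    rw [blockValue_ofFn hL, (bitsValue_injective j).ne_iff]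
    rfl
  rw [h2, ← h3] at h1
  have h4 := congrArg (Nat.cast : ℕ → ℝ) h1
  have h5 : (1 : ℕ) ≤ 2 ^ j := Nat.one_le_two_pow
  push_cast [h5, Fintype.card_prod, Fintype.card_fin] at h4
  have h6 : (2 : ℝ) ^ (M * j) = (2 ^ j) ^ D.card * (2 ^ j) ^ (M - D.card) := by
    rw [← pow_add, Nat.add_sub_cancel' hD, ← pow_mul, mul_comm]
  rw [div_eq_iff (by positivity)]
  have h7 : (1 - 1 / (2 : ℝ) ^ j) ^ D.card * (2 ^ j) ^ D.card = (2 ^ j - 1) ^ D.card := by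
    rw [← mul_pow]; congr 1; field_simp
  rw [h6] at h4
  have h8 : ((2 : ℝ) ^ j) ^ D.card * (2 ^ j) ^ (M - D.card) ≠ 0 := by positivity
  apply mul_right_cancel₀ h8
  rw [h4, ← h7]
  ring

open Classical in
/-- With high probability, a large set `D` of hyperedges hits all groups. -/
theorem le_card_hit {L j M : ℕ} (hL : M * j ≤ L) (D : Finset (Fin M)) :
    1 - 2 ^ j * (1 - 1 / (2 : ℝ) ^ j) ^ D.card ≤
    ((Finset.univ.filter fun ω : Fin L → Bool =>
      ∀ k < 2 ^ j, ∃ i ∈ D, blockValue (List.ofFn ω) j i = k).card : ℝ) / 2 ^ L := by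
  let A : ℕ → Finset (Fin L → Bool) := fun k =>
    Finset.univ.filter fun ω => ∀ i ∈ D, blockValue (List.ofFn ω) j i ≠ k
  have h1 : (Finset.univ.filter fun ω : Fin L → Bool =>
      ∀ k < 2 ^ j, ∃ i ∈ D, blockValue (List.ofFn ω) j i = k)ᶜ ⊆
        (Finset.range (2 ^ j)).biUnion A := by
    intro ω hω
    simp only [Finset.mem_compl, Finset.mem_filter, Finset.mem_univ, true_and] at hω
    push Not at hω
    obtain ⟨k, hk, h⟩ := hω
    exact Finset.mem_biUnion.2 ⟨k, Finset.mem_range.2 hk, by simpa [A] using h⟩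
  have h2 : ((((Finset.range (2 ^ j)).biUnion A).card : ℕ) : ℝ) ≤
      2 ^ j * (1 - 1 / (2 : ℝ) ^ j) ^ D.card * 2 ^ L := by
    calc ((((Finset.range (2 ^ j)).biUnion A).card : ℕ) : ℝ)
        ≤ ((∑ k ∈ Finset.range (2 ^ j), (A k).card : ℕ) : ℝ) := by
          exact_mod_cast Finset.card_biUnion_le
      _ = ∑ k ∈ Finset.range (2 ^ j), (1 - 1 / (2 : ℝ) ^ j) ^ D.card * 2 ^ L := by
          push_cast
          refine Finset.sum_congr rfl fun k hk => ?_
          rw [← card_missed hL D (Finset.mem_range.1 hk), div_mul_cancel₀ _ (by positivity)]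
      _ = _ := by simp; ring
  have h3 := Finset.card_le_card h1
  rw [Finset.card_compl] at h3
  set B := (Finset.univ.filter fun ω : Fin L → Bool =>
      ∀ k < 2 ^ j, ∃ i ∈ D, blockValue (List.ofFn ω) j i = k)
  have h4 : B.card ≤ Fintype.card (Fin L → Bool) := Finset.card_le_univ _
  have h5 : Fintype.card (Fin L → Bool) = 2 ^ L := by simp
  rw [le_div_iff₀ (by positivity)]
  have h6 : ((2 ^ L : ℕ) : ℝ) ≤ ((((Finset.range (2 ^ j)).biUnion A).card : ℕ) : ℝ) + B.card := by
    exact_mod_cast (by omega)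
  push_cast at h6
  linarith

end

/-! ### Random hypergraphs -/

section

/-- The probability that a random subset of `S` contains `F`. -/
theorem sum_superset {α : Type*} [DecidableEq α] (S F : Finset α) (hF : F ⊆ S) (p : ℝ) :
    ∑ H ∈ S.powerset with F ⊆ H, p ^ H.card * (1 - p) ^ (S.card - H.card) = p ^ F.card := by
  have h1 := Finset.sum_pow_mul_eq_add_pow p (1 - p) (S \ F)
  rw [add_sub_cancel, one_pow] at h1
  conv_rhs => rw [← mul_one (p ^ F.card), ← h1, Finset.mul_sum]
  symm
  refine Finset.sum_nbij' (fun T => T ∪ F) (fun H => H \ F) ?_ ?_ ?_ ?_ ?_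
  · intro T hT
    rw [Finset.mem_powerset] at hT
    simp only [Finset.mem_filter, Finset.mem_powerset]
    exact ⟨Finset.union_subset (hT.trans Finset.sdiff_subset) hF, Finset.subset_union_right⟩
  · intro H hH
    simp only [Finset.mem_filter, Finset.mem_powerset] at hH ⊢
    exact Finset.sdiff_subset_sdiff hH.1 le_rfl
  · intro T hT
    rw [Finset.mem_powerset] at hT
    exact Finset.union_sdiff_cancel_right (Finset.disjoint_of_subset_left hT Finset.sdiff_disjoint)
  · intro H hH
    simp only [Finset.mem_filter, Finset.mem_powerset] at hH
    exact Finset.sdiff_union_of_subset hH.2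
  · intro T hT
    rw [Finset.mem_powerset] at hT
    rw [Finset.card_union_of_disjoint (Finset.disjoint_of_subset_left hT Finset.sdiff_disjoint),
      Finset.card_sdiff_of_subset hF, pow_add, add_comm T.card, Nat.sub_add_eq]
    ring

variable {n r : ℕ} {p : ℝ}

theorem card_edges (n r : ℕ) :
    (Finset.powersetCard r (Finset.univ : Finset (Fin n))).card = n.choose r := by simp

theorem randomHypergraphProb_nonneg (h0 : 0 ≤ p) (h1 : p ≤ 1) (H : Finset (Finset (Fin n))) :
    0 ≤ randomHypergraphProb n r p H :=
  mul_nonneg (pow_nonneg h0 _) (pow_nonneg (by linarith) _)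

theorem sum_randomHypergraphProb_superset {F : Finset (Finset (Fin n))}
    (hF : F ∈ uniformHypergraphs n r) :
    ∑ H ∈ uniformHypergraphs n r with F ⊆ H, randomHypergraphProb n r p H = p ^ F.card := by
  have := sum_superset _ F (Finset.mem_powerset.1 hF) p
  rwa [card_edges] at this

theorem sum_randomHypergraphProb (n r : ℕ) (p : ℝ) :
    ∑ H ∈ uniformHypergraphs n r, randomHypergraphProb n r p H = 1 := by
  have := sum_randomHypergraphProb_superset (n := n) (r := r) (p := p) (F := ∅)
    (by simp [uniformHypergraphs])
  simpa using this

/-- The expected number of hyperedges. -/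
theorem sum_randomHypergraphProb_mul_card (n r : ℕ) (p : ℝ) :
    ∑ H ∈ uniformHypergraphs n r, randomHypergraphProb n r p H * H.card = n.choose r * p := by
  have h1 : ∀ H ∈ uniformHypergraphs n r, randomHypergraphProb n r p H * H.card =
      ∑ e ∈ Finset.powersetCard r (Finset.univ : Finset (Fin n)),
        if {e} ⊆ H then randomHypergraphProb n r p H else 0 := by
    intro H hH
    have h2 : (Finset.powersetCard r (Finset.univ : Finset (Fin n))).filter (fun e => {e} ⊆ H) =
        H := by
      ext e
      simp only [Finset.mem_filter, Finset.singleton_subset_iff]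
      exact ⟨fun h => h.2, fun h => ⟨Finset.mem_powerset.1 hH h, h⟩⟩
    rw [← Finset.sum_filter, h2, Finset.sum_const, nsmul_eq_mul, mul_comm]
  rw [Finset.sum_congr rfl h1, Finset.sum_comm]
  have h3 : ∀ e ∈ Finset.powersetCard r (Finset.univ : Finset (Fin n)),
      (∑ H ∈ uniformHypergraphs n r, if {e} ⊆ H then randomHypergraphProb n r p H else 0) = p := by
    intro e he
    rw [← Finset.sum_filter, sum_randomHypergraphProb_superset, Finset.card_singleton, pow_one]
    exact Finset.mem_powerset.2 (Finset.singleton_subset_iff.2 he)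
  rw [Finset.sum_congr rfl h3, Finset.sum_const, card_edges, nsmul_eq_mul]

/-- Markov's inequality for the number of hyperedges. -/
theorem sum_many_edges_le (h0 : 0 ≤ p) (h1 : p ≤ 1) {t : ℝ} (ht : 0 < t) :
    ∑ H ∈ uniformHypergraphs n r with t ≤ H.card, randomHypergraphProb n r p H ≤
      n.choose r * p / t := by
  rw [le_div_iff₀ ht, ← sum_randomHypergraphProb_mul_card, Finset.sum_mul]
  refine (Finset.sum_le_sum fun H hH => ?_).trans
    (Finset.sum_le_sum_of_subset_of_nonneg (Finset.filter_subset _ _) fun H _ _ =>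
      mul_nonneg (randomHypergraphProb_nonneg h0 h1 H) (Nat.cast_nonneg _))
  exact mul_le_mul_of_nonneg_left (Finset.mem_filter.1 hH).2 (randomHypergraphProb_nonneg h0 h1 H)

/-- There are `ℓ` hyperedges inside some set of `u` vertices. -/
def HasConcentratedEdges {n : ℕ} (H : Finset (Finset (Fin n))) (u ℓ : ℕ) : Prop :=
  ∃ U : Finset (Fin n), U.card = u ∧ ∃ F ⊆ H, F.card = ℓ ∧ ∀ e ∈ F, e ⊆ U

open Classical in
/-- The union bound over all sets of `u` vertices and all sets of `ℓ` hyperedges inside them. -/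
theorem sum_concentrated_le (h0 : 0 ≤ p) (h1 : p ≤ 1) (u ℓ : ℕ) :
    ∑ H ∈ uniformHypergraphs n r with HasConcentratedEdges H u ℓ, randomHypergraphProb n r p H ≤
      (n : ℝ) ^ u * ((u : ℝ) ^ r * p) ^ ℓ := by
  let Q : Finset (Finset (Finset (Fin n))) := (Finset.powersetCard u Finset.univ).biUnion fun U =>
    Finset.powersetCard ℓ (Finset.powersetCard r U)
  have hw := randomHypergraphProb_nonneg (n := n) (r := r) h0 h1
  have hQu : ∀ F ∈ Q, F ∈ uniformHypergraphs n r ∧ F.card = ℓ := by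
    intro F hF
    obtain ⟨U, -, hF⟩ := Finset.mem_biUnion.1 hF
    obtain ⟨hF, hc⟩ := Finset.mem_powersetCard.1 hF
    exact ⟨Finset.mem_powerset.2
      (hF.trans (Finset.powersetCard_mono (Finset.subset_univ _))), hc⟩
  have hQcard : Q.card ≤ n ^ u * u ^ (r * ℓ) := by
    refine (Finset.card_biUnion_le_card_mul _ _ ((u.choose r).choose ℓ) fun U hU => ?_).trans ?_
    · rw [Finset.card_powersetCard, Finset.card_powersetCard, (Finset.mem_powersetCard.1 hU).2]
    · rw [Finset.card_powersetCard, Finset.card_univ, Fintype.card_fin, pow_mul]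
      gcongr
      · exact Nat.choose_le_pow n u
      · exact (Nat.choose_le_pow _ _).trans (Nat.pow_le_pow_left (Nat.choose_le_pow u r) ℓ)
  calc ∑ H ∈ uniformHypergraphs n r with HasConcentratedEdges H u ℓ, randomHypergraphProb n r p H
      ≤ ∑ H ∈ uniformHypergraphs n r, ∑ F ∈ Q,
          if F ⊆ H then randomHypergraphProb n r p H else 0 := by
        rw [Finset.sum_filter]
        refine Finset.sum_le_sum fun H hH => ?_
        have hnn : ∀ F ∈ Q, 0 ≤ if F ⊆ H then randomHypergraphProb n r p H else 0 := by
          intro F _; split_ifs; exacts [hw H, le_rfl]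
        split_ifs with hc
        · obtain ⟨U, hU, F, hFH, hF, hFU⟩ := hc
          have hFQ : F ∈ Q := Finset.mem_biUnion.2 ⟨U, by simp [Finset.mem_powersetCard, hU],
            Finset.mem_powersetCard.2 ⟨fun e he => Finset.mem_powersetCard.2 ⟨hFU e he,
              (Finset.mem_powersetCard.1 (Finset.mem_powerset.1 hH (hFH he))).2⟩, hF⟩⟩
          have := Finset.single_le_sum hnn hFQ
          rwa [if_pos hFH] at this
        · exact Finset.sum_nonneg hnn
    _ = ∑ F ∈ Q, p ^ ℓ := by
        rw [Finset.sum_comm]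
        refine Finset.sum_congr rfl fun F hF => ?_
        rw [← Finset.sum_filter, sum_randomHypergraphProb_superset (hQu F hF).1, (hQu F hF).2]
    _ ≤ (n ^ u * u ^ (r * ℓ) : ℕ) * p ^ ℓ := by
        rw [Finset.sum_const, nsmul_eq_mul]
        exact mul_le_mul_of_nonneg_right (by exact_mod_cast hQcard) (pow_nonneg h0 _)
    _ = _ := by
        push_cast
        rw [mul_pow, ← pow_mul]
        ring

end

/-! ### The distinguishing algorithm -/

section

variable {P : Instance → Prop} {ρ : Instance → ℝ}

theorem encodeWalk_eq (I : Instance) {u v : Fin I.n} (w : I.G.Walk u v) :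
    I.encodeWalk w = enc (w.support.map fun x : Fin I.n => x.val) := by
  simp only [Instance.encodeWalk, list_bind_coe_eq_map, List.map_map]
  simp only [enc, List.map_map]

theorem groups_lt (M j : ℕ) (coins : List Bool) : ∀ y ∈ groups M j coins, y < 2 ^ j := by
  intro y hy
  obtain ⟨i, -, rfl⟩ := List.mem_map.1 hy
  exact blockValue_lt _ _ _

theorem length_groups (M j : ℕ) (coins : List Bool) : (groups M j coins).length = M := by
  simp [groups]

theorem getD_groups {M j : ℕ} (coins : List Bool) {i : ℕ} (hi : i < M) :
    (groups M j coins).getD i 0 = blockValue coins j i := by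
  simp [groups, hi]

theorem reductionInstance_reachable {a ℓ N : ℕ} {g : List ℕ} {E : List (List ℕ)}
    (hE : g.length = E.length) (hhit : allGroupsHit ℓ g = true) :
    (reductionInstance a ℓ N g E).G.Reachable (reductionInstance a ℓ N g E).s
      (reductionInstance a ℓ N g E).t := by
  obtain ⟨w, -⟩ := exists_path_of_hit (a := a) (N := N) hE Set.univ Finset.univ (by simp)
    (fun k hk => by
      simp only [allGroupsHit, List.all_eq_true, List.mem_range, List.any_eq_true, beq_iff_eq,
        exists_eq_right] at hhit
      obtain ⟨i, hi, hi'⟩ := List.getElem_of_mem (hhit k hk)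
      exact ⟨i, trivial, hi, (List.getD_eq_getElem _ _ hi).trans hi'⟩)
  exact w.reachable

/-- The possible verdicts on a hypergraph with `N` vertices, hyperedges `E` and groups `g`:
"dense" if there are more than `N ^ (G / B)` hyperedges, "sparse" if some group is empty, and
otherwise "dense" if and only if the path found has at most `N ^ (1 - 1 / B)` colors. -/
inductive Verdict (ρ : Instance → ℝ) (a B G N : ℕ) (E : List (List ℕ)) (g : List ℕ) : Bool → Prop
  | manyEdges : N ^ G < E.length ^ B → Verdict ρ a B G N E g true
  | emptyGroup : allGroupsHit (2 ^ Nat.log 2 N) g = false → Verdict ρ a B G N E g false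
  | path (b : Bool)
      (w : (reductionInstance a (2 ^ Nat.log 2 N) N g E).G.Walk
        (reductionInstance a (2 ^ Nat.log 2 N) N g E).s
        (reductionInstance a (2 ^ Nat.log 2 N) N g E).t) :
      E.length ^ B ≤ N ^ G → allGroupsHit (2 ^ Nat.log 2 N) g = true →
      (∀ w' : (reductionInstance a (2 ^ Nat.log 2 N) N g E).G.Walk
          (reductionInstance a (2 ^ Nat.log 2 N) N g E).s
          (reductionInstance a (2 ^ Nat.log 2 N) N g E).t, w'.IsPath →
        ((reductionInstance a (2 ^ Nat.log 2 N) N g E).numColors w : ℝ) ≤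
          ρ (reductionInstance a (2 ^ Nat.log 2 N) N g E) *
            ((reductionInstance a (2 ^ Nat.log 2 N) N g E).numColors w' : ℝ)) →
      (b = true ↔ (reductionInstance a (2 ^ Nat.log 2 N) N g E).numColors w ^ B ≤ N ^ (B - 1)) →
      Verdict ρ a B G N E g b

/-- The distinguisher as a program: the given approximation algorithm is only run if there are few
hyperedges and no group is empty, so that it is applied to a legitimate instance. -/
theorem exists_decider (h : PolyTimeApproximable P ρ) (a B G : ℕ)
    (hP : ∀ (ℓ N : ℕ) (g : List ℕ) (E : List (List ℕ)), (∀ y ∈ g, y < ℓ) →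
      g.length = E.length → allGroupsHit ℓ g = true → P (reductionInstance a ℓ N g E)) :
    ∃ (q : Prog) (T : Polynomial ℕ), ∀ (N : ℕ) (E : List (List ℕ)) (coins : List Bool),
      ∃ (b : Bool) (t : ℕ), q.Runs (enc ((N, E), coins)) (Data.ofBool b) t ∧
        t ≤ T.eval (encSize ((N, E), coins)) ∧
        Verdict ρ a B G N E (groups E.length (Nat.log 2 N) coins) b := by
  obtain ⟨p, Tp, hp⟩ := h
  let grp (x : (ℕ × List (List ℕ)) × List Bool) : List ℕ :=
    groups x.1.2.length (Nat.log 2 x.1.1) x.2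
  have hgrp : PolyTime grp := .groups (by fun_prop) (by fun_prop) (by fun_prop)
  have h1 : PolyTime fun x : (ℕ × List (List ℕ)) × List Bool =>
      decide (x.1.1 ^ G < x.1.2.length ^ B) := by fun_prop
  have h2 : PolyTime fun x : (ℕ × List (List ℕ)) × List Bool =>
      allGroupsHit (2 ^ Nat.log 2 x.1.1) (grp x) := .allGroupsHit (by fun_prop) hgrp
  have h3 : PolyTime fun x : (ℕ × List (List ℕ)) × List Bool =>
      instanceCode a (2 ^ Nat.log 2 x.1.1) x.1.1 (grp x) x.1.2 :=
    .instanceCode a (by fun_prop) (by fun_prop) hgrp (by fun_prop)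
  have h4 : PolyTime fun y : ((ℕ × List (List ℕ)) × List Bool) × List ℕ =>
      decide (countColors (2 ^ Nat.log 2 y.1.1.1) y.1.1.1 y.1.1.2 y.2 ^ B ≤ y.1.1.1 ^ (B - 1)) :=
    .decide_le (.pow_const (.countColors (by fun_prop) (by fun_prop) (by fun_prop) (by fun_prop)) _)
      (by fun_prop)
  have h5 : ∀ b : Bool, PolyTime fun _ : (ℕ × List (List ℕ)) × List Bool => b :=
    fun b => by fun_prop
  obtain ⟨q₁, T₁, h1⟩ := h1
  obtain ⟨q₂, T₂, h2⟩ := h2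
  obtain ⟨q₃, T₃, h3⟩ := h3
  obtain ⟨q₄, T₄, h4⟩ := h4
  obtain ⟨q₅, T₅, h5t⟩ := h5 true
  obtain ⟨q₆, T₆, h5f⟩ := h5 false
  -- the size of the input together with the path that has been found
  let S : Polynomial ℕ := .X + Tp.comp T₃ + 1
  refine ⟨.ite q₁ q₅ (.ite q₂ (.comp q₄ (.pair .id (.comp p q₃))) q₆),
    T₁ + T₂ + T₃ + T₄.comp S + T₅ + T₆ + Tp.comp T₃ + 10 * .X, fun N E coins => ?_⟩
  simp only [Polynomial.eval_add, Polynomial.eval_mul, Polynomial.eval_X, Polynomial.eval_ofNat,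
    Polynomial.eval_comp]
  obtain ⟨t₁, r₁, s₁⟩ := h1 ((N, E), coins)
  obtain ⟨t₂, r₂, s₂⟩ := h2 ((N, E), coins)
  obtain ⟨t₃, r₃, s₃⟩ := h3 ((N, E), coins)
  obtain ⟨t₅, r₅, s₅⟩ := h5t ((N, E), coins)
  obtain ⟨t₆, r₆, s₆⟩ := h5f ((N, E), coins)
  change q₁.Runs _ (Data.ofBool (decide (N ^ G < E.length ^ B))) _ at r₁
  by_cases c₁ : N ^ G < E.length ^ B
  · rw [decide_eq_true c₁] at r₁
    exact ⟨true, _, .ite_true r₁ r₅, by unfold encSize at *; omega, .manyEdges c₁⟩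
  rw [decide_eq_false c₁] at r₁
  change q₂.Runs _ (Data.ofBool (allGroupsHit (2 ^ Nat.log 2 N)
    (groups E.length (Nat.log 2 N) coins))) _ at r₂
  cases c₂ : allGroupsHit (2 ^ Nat.log 2 N) (groups E.length (Nat.log 2 N) coins) with
  | false =>
    rw [c₂] at r₂
    exact ⟨false, _, .ite_false r₁ (.ite_false r₂ r₆), by unfold encSize at *; omega,
      .emptyGroup c₂⟩
  | true =>
    rw [c₂] at r₂
    have hlen := length_groups E.length (Nat.log 2 N) coins
    obtain ⟨w, τ, rw', hτ, -, hw⟩ := hp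
      (reductionInstance a (2 ^ Nat.log 2 N) N (groups E.length (Nat.log 2 N) coins) E)
      (hP _ _ _ _ (groups_lt _ _ _) hlen c₂) (reductionInstance_reachable hlen c₂)
    rw [encode_reductionInstance] at rw' hτ
    rw [encodeWalk_eq] at rw'
    obtain ⟨t₄, r₄, s₄⟩ := h4 (((N, E), coins), w.support.map fun x => x.val)
    refine ⟨_, _, .ite_false r₁ (.ite_true r₂ (.comp (.pair (.id _) (.comp r₃ rw')) r₄)), ?_,
      .path _ w (not_lt.1 c₁) c₂ hw ?_⟩
    · have e1 := hτ.trans (eval_mono Tp (r₃.size_le.trans s₃))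
      have e2 : encSize (((N, E), coins), w.support.map fun x => x.val) ≤
          S.eval (encSize ((N, E), coins)) := by
        have := rw'.size_le.trans e1
        simp only [S, encSize_prod (α := (ℕ × List (List ℕ)) × List Bool), Polynomial.eval_add,
          Polynomial.eval_X, Polynomial.eval_one, Polynomial.eval_comp]
        unfold encSize at *
        omega
      have e3 := s₄.trans (eval_mono T₄ e2)
      unfold encSize at *
      omega
    · rw [decide_eq_true_eq]
      exact iff_of_eq (congrArg (fun c => c ^ B ≤ N ^ (B - 1)) (countColors_support w))

end

/-! ### Correctness on dense hypergraphs -/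

section

variable {ρ : Instance → ℝ} {a B G n r : ℕ} {H : Finset (Finset (Fin n))} {b : Bool}

theorem length_edgeCode_eq : (edgeCode n r H).length = (edgeList n r H).length := by
  rw [edgeCode, List.length_map]

/-- The indices of the hyperedges inside `S`. -/
def edgesInside (r : ℕ) (H : Finset (Finset (Fin n))) (S : Finset (Fin n)) :
    Finset (Fin (edgeCode n r H).length) :=
  Finset.univ.filter fun i =>
    ((edgeList n r H)[i.val]'(i.2.trans_eq length_edgeCode_eq)).toFinset ⊆ S

theorem card_le_card_edgesInside (hH : H ∈ uniformHypergraphs n r) (S : Finset (Fin n)) :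
    (H.filter fun e => e ⊆ S).card ≤ (edgesInside r H S).card := by
  have hlen : ∀ i : Fin (edgeCode n r H).length, i.val < (edgeList n r H).length := fun i =>
    i.2.trans_eq length_edgeCode_eq
  refine (Finset.card_le_card fun e he => ?_).trans
    (Finset.card_image_le (s := edgesInside r H S)
      (f := fun i => ((edgeList n r H)[i.val]'(hlen i)).toFinset))
  obtain ⟨he, heS⟩ := Finset.mem_filter.1 he
  obtain ⟨l, hl, rfl⟩ := exists_mem_edgeList hH he
  obtain ⟨i, hi, rfl⟩ := List.getElem_of_mem hl
  refine Finset.mem_image.2 ⟨⟨i, hi.trans_eq length_edgeCode_eq.symm⟩, ?_, rfl⟩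
  simpa [edgesInside] using heS

theorem mem_edgeCode_getD {i : ℕ} (hi : i < (edgeList n r H).length) (c : Fin n) :
    (c : ℕ) ∈ (edgeCode n r H).getD i [] ↔ c ∈ ((edgeList n r H)[i]).toFinset := by
  simp [edgeCode, hi, Fin.val_inj]

/-- If the hyperedges inside `S` hit all groups, then the verdict is "dense". -/
theorem Verdict.eq_true {coins : List Bool} (S : Finset (Fin n))
    (hv : Verdict ρ a B G n (edgeCode n r H)
      (groups (edgeCode n r H).length (Nat.log 2 n) coins) b)
    (hρ : (edgeCode n r H).length ^ B ≤ n ^ G →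
      0 ≤ ρ (reductionInstance a (2 ^ Nat.log 2 n) n
        (groups (edgeCode n r H).length (Nat.log 2 n) coins) (edgeCode n r H)) ∧
      (ρ (reductionInstance a (2 ^ Nat.log 2 n) n
        (groups (edgeCode n r H).length (Nat.log 2 n) coins) (edgeCode n r H)) * S.card) ^ B ≤
        (n : ℝ) ^ (B - 1))
    (hhit : ∀ k < 2 ^ Nat.log 2 n, ∃ i ∈ edgesInside r H S,
      blockValue coins (Nat.log 2 n) i = k) : b = true := by
  cases hv with
  | manyEdges => rfl
  | emptyGroup h =>
    rw [← Bool.not_eq_true] at h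
    refine absurd ?_ h
    simp only [allGroupsHit, List.all_eq_true, List.mem_range, List.any_eq_true, beq_iff_eq,
      exists_eq_right]
    intro k hk
    obtain ⟨i, -, hi⟩ := hhit k hk
    exact List.mem_map.2 ⟨i, List.mem_range.2 i.2, hi⟩
  | path b w hM _ hw hb =>
    refine hb.2 ?_
    have hlen : ∀ i : Fin (edgeCode n r H).length, i.val < (edgeList n r H).length := fun i =>
      i.2.trans_eq length_edgeCode_eq
    obtain ⟨w', hw', hS⟩ := exists_path_of_hit (a := a) (ℓ := 2 ^ Nat.log 2 n)
      (g := groups (edgeCode n r H).length (Nat.log 2 n) coins) (E := edgeCode n r H)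
      (length_groups _ _ _)
      {i | ∃ i' ∈ edgesInside r H S, i'.val = i} S (by
        rintro _ ⟨i, hi, rfl⟩ c hc
        rw [mem_edgeCode_getD (hlen i)] at hc
        exact (Finset.mem_filter.1 hi).2 hc) (by
        intro k hk
        obtain ⟨i, hi, hik⟩ := hhit k hk
        exact ⟨i, ⟨i, hi, rfl⟩, by rw [length_groups]; exact i.2, by
          rw [getD_groups _ i.2, hik]⟩)
    obtain ⟨hρ0, hρ1⟩ := hρ hM
    have h1 := (hw w' hw').trans (mul_le_mul_of_nonneg_left (Nat.cast_le.2 hS) hρ0)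
    have h2 := (pow_le_pow_left₀ (Nat.cast_nonneg _) h1 B).trans hρ1
    exact_mod_cast h2

/-! ### Correctness on sparse hypergraphs -/

/-- If `H` has few hyperedges and they are not concentrated on few vertices, then the verdict is
"sparse". -/
theorem Verdict.eq_false {coins : List Bool} {u : ℕ} (hn : 2 ≤ n) (hB : 1 ≤ B) (hu : u ≤ n)
    (huB : ∀ X : ℕ, X ^ B ≤ n ^ (B - 1) → X ≤ u)
    (hv : Verdict ρ a B G n (edgeCode n r H)
      (groups (edgeCode n r H).length (Nat.log 2 n) coins) b)
    (hM : (edgeCode n r H).length ^ B ≤ n ^ G)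
    (hconc : ¬ HasConcentratedEdges H u (2 ^ Nat.log 2 n)) : b = false := by
  cases hv with
  | manyEdges h => exact absurd hM (not_le.2 h)
  | emptyGroup => rfl
  | path b w _ _ _ hb =>
    rw [← Bool.not_eq_true, hb]
    intro hX
    have hlen : ∀ i < (edgeCode n r H).length, i < (edgeList n r H).length := fun i hi =>
      hi.trans_eq length_edgeCode_eq
    rcases exists_edges_of_walk (length_groups _ _ _) w with h | ⟨f, hf⟩
    · have h1 : n ^ B ≤ n ^ (B - 1) := (Nat.pow_le_pow_left h B).trans hX
      have h2 := (Nat.pow_le_pow_iff_right (by omega)).1 h1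
      omega
    · apply hconc
      obtain ⟨U, hU, hUcard⟩ := Finset.exists_superset_card_eq (s := Instance.colors _ w)
        (huB _ hX) (hu.trans (Fintype.card_fin n).ge)
      have hfM : ∀ k, f k < (edgeCode n r H).length := fun k => by
        have := (hf k).1
        rwa [length_groups] at this
      let e : Fin (2 ^ Nat.log 2 n) → Finset (Fin n) := fun k =>
        ((edgeList n r H)[f k]'(hlen _ (hfM k))).toFinset
      have he : Function.Injective e := by
        intro k k' h
        have h1 : f k = f k' := by
          have := (List.nodup_iff_injective_getElem.1 (nodup_edgeList (n := n) (r := r) (H := H)))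
            (a₁ := ⟨f k, by simpa using hlen _ (hfM k)⟩)
            (a₂ := ⟨f k', by simpa using hlen _ (hfM k')⟩) (by simpa [e] using h)
          exact congrArg Fin.val this
        refine Fin.ext ?_
        rw [← (hf k).2.1, ← (hf k').2.1, h1]
      refine ⟨U, hUcard, Finset.univ.image e, ?_, ?_, ?_⟩
      · intro x hx
        obtain ⟨k, -, rfl⟩ := Finset.mem_image.1 hx
        exact toFinset_mem_of_mem_edgeList (List.getElem_mem _)
      · rw [Finset.card_image_of_injective _ he, Finset.card_univ, Fintype.card_fin]
      · intro x hx
        obtain ⟨k, -, rfl⟩ := Finset.mem_image.1 hx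
        intro c hc
        exact hU ((hf k).2.2 c ((mem_edgeCode_getD (hlen _ (hfM k)) c).2 hc))

end

/-! ### From approximation to distinguishing -/

section

/-- Finitely many exceptions to a high-probability bound are absorbed by the constant. -/
theorem exists_const_of_eventually {ι : ℕ → Type*} {f : ∀ n, ι n → ℝ} {c : ℝ} (hc : 0 < c)
    (hf : ∀ n x, 0 ≤ f n x) (h : ∀ᶠ n : ℕ in atTop, ∀ x, 1 - (n : ℝ) ^ (-c) ≤ f n x) :
    ∃ C : ℝ, ∀ n : ℕ, 1 ≤ n → ∀ x, 1 - C * (n : ℝ) ^ (-c) ≤ f n x := by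
  obtain ⟨n₀, h⟩ := eventually_atTop.1 h
  refine ⟨max 1 ((n₀ : ℝ) ^ c), fun n hn x => ?_⟩
  have hpos : (0 : ℝ) < n := by exact_mod_cast hn
  have hpow := Real.rpow_pos_of_pos hpos (-c)
  rcases le_or_gt n₀ n with hn₀ | hn₀
  · refine le_trans ?_ (h n hn₀ x)
    have := mul_le_mul_of_nonneg_right (le_max_left 1 ((n₀ : ℝ) ^ c)) hpow.le
    linarith
  · refine le_trans ?_ (hf n x)
    have h1 : (n : ℝ) ^ c ≤ (n₀ : ℝ) ^ c :=
      Real.rpow_le_rpow hpos.le (by exact_mod_cast hn₀.le) hc.le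
    have h2 := mul_le_mul_of_nonneg_right (h1.trans (le_max_right 1 ((n₀ : ℝ) ^ c))) hpow.le
    rw [← Real.rpow_add hpos, add_neg_cancel, Real.rpow_zero] at h2
    linarith

theorem outputProb_nonneg (p : Prog) (L : ℕ) (x y : Data) : 0 ≤ outputProb p L x y := by
  unfold outputProb
  positivity

variable {P : Instance → Prop} {ρ : Instance → ℝ}

/-- The reduction. An algorithm for Min-Color Path distinguishes dense from random hypergraphs if
its ratio is small compared to `n ^ (1 - 1 / B) / k n` on the instances of the reduction, if
`k n ^ (1 + β)` is large enough to hit all the at most `n` groups, and if random hypergraphs have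
few hyperedges, but no concentrated ones. -/
theorem DenseVsRandomSolvable.of_approximable (h : PolyTimeApproximable P ρ) {a B G r : ℕ}
    (ha : a ≤ 1) (hB : 1 ≤ B)
    (hP : ∀ (ℓ N : ℕ) (g : List ℕ) (E : List (List ℕ)), (∀ y ∈ g, y < ℓ) →
      g.length = E.length → allGroupsHit ℓ g = true → P (reductionInstance a ℓ N g E))
    {α β c : ℝ} {k u : ℕ → ℕ} (hα : α ≤ (r : ℝ) - 1) (hc : 0 < c)
    (hρ : ∀ᶠ n : ℕ in atTop, ∀ M : ℕ, M ^ B ≤ n ^ G → ∀ I : Instance, I.m = n →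
      I.n ≤ n + 2 + M → 0 ≤ ρ I ∧ (ρ I * k n) ^ B ≤ (n : ℝ) ^ (B - 1))
    (hu : ∀ n, u n ≤ n) (huB : ∀ n X : ℕ, X ^ B ≤ n ^ (B - 1) → X ≤ u n)
    (hdense : ∀ᶠ n : ℕ in atTop,
      (n : ℝ) * Real.exp (-((k n : ℝ) ^ (1 + β) / n)) ≤ (n : ℝ) ^ (-c))
    (hsparse : ∀ᶠ n : ℕ in atTop, (n : ℝ) ^ (1 + α - G / B) +
      (n : ℝ) ^ u n * ((u n : ℝ) ^ r * (n : ℝ) ^ (α - ((r : ℝ) - 1))) ^ 2 ^ Nat.log 2 n ≤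
        (n : ℝ) ^ (-c)) :
    DenseVsRandomSolvable r α β k := by
  classical
  obtain ⟨q, T, hq⟩ := exists_decider h a B G hP
  have hrun : ∀ (n : ℕ) (H : Finset (Finset (Fin n))) (L : ℕ) (ω : Fin L → Bool),
      ∃ (b : Bool) (t : ℕ), q.Runs (withCoins (encodeHypergraph n r H) ω) (Data.ofBool b) t ∧
        t ≤ T.eval (withCoins (encodeHypergraph n r H) ω).size ∧
        Verdict ρ a B G n (edgeCode n r H)
          (groups (edgeCode n r H).length (Nat.log 2 n) (List.ofFn ω)) b := by
    intro n H L ω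
    rw [encodeHypergraph_eq]
    exact hq n (edgeCode n r H) (List.ofFn ω)
  -- there are enough random bits for all hyperedges
  have hL : ∀ (n : ℕ) (H : Finset (Finset (Fin n))), (edgeCode n r H).length * Nat.log 2 n ≤
      (Polynomial.X ^ 2 : Polynomial ℕ).eval (encodeHypergraph n r H).size := by
    intro n H
    rw [encodeHypergraph_eq]
    change _ ≤ Polynomial.eval (encSize (n, edgeCode n r H)) _
    have h1 := length_le_encSize (edgeCode n r H)
    have h2 := Nat.log_le_self 2 n
    rw [encSize_prod, encSize_nat, Polynomial.eval_pow, Polynomial.eval_X, sq]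
    exact Nat.mul_le_mul (by omega) (by omega)
  refine ⟨q, .X ^ 2, T.comp (.X + 4 * .X ^ 2 + 2), fun n H _ ω => ?_, ⟨c, ?_⟩, ⟨c, ?_⟩⟩
  · obtain ⟨b, t, hr, ht, -⟩ := hrun n H _ ω
    refine ⟨b, t, hr, ht.trans ?_⟩
    rw [Polynomial.eval_comp]
    refine eval_mono T ?_
    have h1 := encSize_le_of_forall (List.ofFn ω) 3 fun b _ => encSize_bool_le b
    have h2 : (withCoins (encodeHypergraph n r H) ω).size =
        (encodeHypergraph n r H).size + encSize (List.ofFn ω) + 1 := rfl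
    rw [h2]
    simp only [List.length_ofFn, Polynomial.eval_add, Polynomial.eval_mul, Polynomial.eval_X,
      Polynomial.eval_ofNat, Polynomial.eval_pow] at h1 ⊢
    omega
  · obtain ⟨C, hC⟩ := exists_const_of_eventually
      (ι := fun n => {H : Finset (Finset (Fin n)) // H ∈ uniformHypergraphs n r ∧
        HasDenseSubhypergraph H (k n) ((k n : ℝ) ^ (1 + β))})
      (f := fun n H => outputProb q
        ((Polynomial.X ^ 2 : Polynomial ℕ).eval (encodeHypergraph n r H.1).size)
        (encodeHypergraph n r H.1) (Data.ofBool true)) hc (fun n H => outputProb_nonneg _ _ _ _) (by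
      filter_upwards [hρ, hdense, eventually_ge_atTop 1] with n hρ hdense hn
      rintro ⟨H, hH, S, hS, hq⟩
      have hhit := le_card_hit (hL n H) (edgesInside r H S)
      have hn0 : (0 : ℝ) < n := by exact_mod_cast hn
      have hpow : (2 : ℝ) ^ Nat.log 2 n ≤ n := by
        exact_mod_cast Nat.pow_log_le_self 2 (by omega)
      have hpow1 : (1 : ℝ) ≤ 2 ^ Nat.log 2 n := one_le_pow₀ one_le_two
      have hmiss : (2 : ℝ) ^ Nat.log 2 n *
          (1 - 1 / (2 : ℝ) ^ Nat.log 2 n) ^ (edgesInside r H S).card ≤ (n : ℝ) ^ (-c) := by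
        refine le_trans ?_ hdense
        have h1 : 1 - 1 / (2 : ℝ) ^ Nat.log 2 n ≤ Real.exp (-(1 / n)) := by
          have h2 := Real.one_sub_le_exp_neg (1 / (2 : ℝ) ^ Nat.log 2 n)
          refine h2.trans (Real.exp_le_exp.2 (neg_le_neg ?_))
          exact one_div_le_one_div_of_le (by positivity) hpow
        have h2 : 0 ≤ 1 - 1 / (2 : ℝ) ^ Nat.log 2 n := by
          rw [sub_nonneg, div_le_one (by positivity)]
          exact hpow1
        have h3 : ((k n : ℝ) ^ (1 + β)) ≤ (edgesInside r H S).card :=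
          hq.trans (Nat.cast_le.2 (card_le_card_edgesInside hH S))
        calc _ ≤ (n : ℝ) * Real.exp (-(1 / n)) ^ (edgesInside r H S).card := by gcongr
          _ = n * Real.exp (-((edgesInside r H S).card / n)) := by
            rw [← Real.exp_nat_mul]
            congr 2
            ring
          _ ≤ _ := by gcongr
      refine le_trans (by linarith) (hhit.trans ?_)
      unfold outputProb
      gcongr with ω
      intro hω
      obtain ⟨b, t, hr, -, hv⟩ := hrun n H _ ω
      have hb : b = true := hv.eq_true S (fun hM => by
        rw [hS]
        refine hρ _ hM _ rfl ?_
        change 2 ^ Nat.log 2 n + 1 + (groups _ _ _).length + a ≤ _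
        rw [length_groups]
        have : 2 ^ Nat.log 2 n ≤ n := Nat.pow_log_le_self 2 (by omega)
        omega) hω
      exact ⟨t, hb ▸ hr⟩)
    exact ⟨C, hc, fun n hn H hH hd => hC n hn ⟨H, hH, hd⟩⟩
  · have hp0 : ∀ n : ℕ, 0 ≤ (n : ℝ) ^ (α - ((r : ℝ) - 1)) := fun n => by positivity
    have hp1 : ∀ n : ℕ, (n : ℝ) ^ (α - ((r : ℝ) - 1)) ≤ 1 := fun n => by
      rcases Nat.eq_zero_or_pos n with rfl | hn
      · simpa using Real.zero_rpow_le_one _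
      · exact Real.rpow_le_one_of_one_le_of_nonpos (by exact_mod_cast hn) (by linarith)
    have hmain : ∀ᶠ n : ℕ in atTop, 1 - (n : ℝ) ^ (-c) ≤ ∑ H ∈ uniformHypergraphs n r,
        randomHypergraphProb n r ((n : ℝ) ^ (α - ((r : ℝ) - 1))) H *
          outputProb q ((Polynomial.X ^ 2 : Polynomial ℕ).eval (encodeHypergraph n r H).size)
            (encodeHypergraph n r H) (Data.ofBool false) := by
      filter_upwards [hsparse, eventually_ge_atTop 2] with n hsparse hn
      have hn0 : (0 : ℝ) < n := by exact_mod_cast (by omega : 0 < n)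
      set p := (n : ℝ) ^ (α - ((r : ℝ) - 1)) with hp
      have hw := randomHypergraphProb_nonneg (n := n) (hp0 n) (hp1 n) (r := r)
      have hmany := sum_many_edges_le (n := n) (r := r) (hp0 n) (hp1 n)
        (t := (n : ℝ) ^ ((G : ℝ) / B)) (by positivity)
      have hconc := sum_concentrated_le (n := n) (r := r) (hp0 n) (hp1 n)
        (u n) (2 ^ Nat.log 2 n)
      have hexp : (n.choose r : ℝ) * p / (n : ℝ) ^ ((G : ℝ) / B) ≤ (n : ℝ) ^ (1 + α - G / B) := by
        have h1 : (n.choose r : ℝ) ≤ (n : ℝ) ^ (r : ℝ) := by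
          rw [Real.rpow_natCast]
          exact_mod_cast Nat.choose_le_pow n r
        calc _ ≤ (n : ℝ) ^ (r : ℝ) * p / (n : ℝ) ^ ((G : ℝ) / B) := by
              gcongr
          _ = _ := by
            rw [hp, ← Real.rpow_add hn0, ← Real.rpow_sub hn0]
            congr 1
            ring
      have hout : ∀ H ∈ uniformHypergraphs n r, randomHypergraphProb n r p H -
          (if (n : ℝ) ^ ((G : ℝ) / B) ≤ H.card then randomHypergraphProb n r p H else 0) -
          (if HasConcentratedEdges H (u n) (2 ^ Nat.log 2 n) then
            randomHypergraphProb n r p H else 0) ≤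
          randomHypergraphProb n r p H *
            outputProb q ((Polynomial.X ^ 2 : Polynomial ℕ).eval (encodeHypergraph n r H).size)
              (encodeHypergraph n r H) (Data.ofBool false) := by
        intro H hH
        have hnn := mul_nonneg (hw H) (outputProb_nonneg q
          ((Polynomial.X ^ 2 : Polynomial ℕ).eval (encodeHypergraph n r H).size)
          (encodeHypergraph n r H) (Data.ofBool false))
        have hwH := hw H
        split_ifs with h1 h2 h2
        · linarith
        · linarith
        · linarith
        · have hM : (edgeCode n r H).length ^ B ≤ n ^ G := by
            rw [length_edgeCode hH]
            have h3 : ((H.card : ℝ)) ^ B ≤ ((n : ℝ) ^ ((G : ℝ) / B)) ^ B :=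
              pow_le_pow_left₀ (Nat.cast_nonneg _) (not_le.1 h1).le B
            rw [← Real.rpow_natCast (_ ^ _) B, ← Real.rpow_mul hn0.le,
              div_mul_cancel₀ _ (by positivity), Real.rpow_natCast] at h3
            exact_mod_cast h3
          have hone : outputProb q
              ((Polynomial.X ^ 2 : Polynomial ℕ).eval (encodeHypergraph n r H).size)
              (encodeHypergraph n r H) (Data.ofBool false) = 1 := by
            unfold outputProb
            rw [Finset.filter_true_of_mem, Finset.card_univ]
            · simp
            · intro ω _
              obtain ⟨b, t, hr, -, hv⟩ := hrun n H _ ω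
              have hb : b = false := hv.eq_false hn hB (hu n) (huB n) hM h2
              exact ⟨t, hb ▸ hr⟩
          rw [hone]
          linarith
      refine le_trans ?_ (Finset.sum_le_sum hout)
      rw [Finset.sum_sub_distrib, Finset.sum_sub_distrib, sum_randomHypergraphProb,
        ← Finset.sum_filter, ← Finset.sum_filter]
      linarith
    obtain ⟨C, hC⟩ := exists_const_of_eventually (ι := fun _ => Unit)
      (f := fun n _ => ∑ H ∈ uniformHypergraphs n r,
        randomHypergraphProb n r ((n : ℝ) ^ (α - ((r : ℝ) - 1))) H *
          outputProb q ((Polynomial.X ^ 2 : Polynomial ℕ).eval (encodeHypergraph n r H).size)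
            (encodeHypergraph n r H) (Data.ofBool false)) hc
      (fun n _ => Finset.sum_nonneg fun H _ =>
        mul_nonneg (randomHypergraphProb_nonneg (hp0 n) (hp1 n) H) (outputProb_nonneg _ _ _ _))
      (hmain.mono fun n h _ => h)
    exact ⟨C, hc, fun n hn => hC n hn ()⟩

end

/-! ### Asymptotics -/

section

theorem eventually_const_mul_rpow_le {C a b : ℝ} (hab : a < b) :
    ∀ᶠ n : ℕ in atTop, C * (n : ℝ) ^ a ≤ (n : ℝ) ^ b := by
  have h1 := (tendsto_rpow_atTop (sub_pos.2 hab)).comp tendsto_natCast_atTop_atTop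
  filter_upwards [h1.eventually_ge_atTop C, eventually_ge_atTop 1] with n hn hn1
  have hpos : (0 : ℝ) < n := by exact_mod_cast hn1
  calc C * (n : ℝ) ^ a ≤ (n : ℝ) ^ (b - a) * (n : ℝ) ^ a := by gcongr; exact hn
    _ = (n : ℝ) ^ b := by rw [← Real.rpow_add hpos, sub_add_cancel]

theorem half_rpow_le_floor {κ : ℝ} (hκ : 0 < κ) {n : ℕ} (hn : 1 ≤ n) :
    (n : ℝ) ^ κ / 2 ≤ (⌊(n : ℝ) ^ κ⌋₊ : ℝ) := by
  have h1 : (1 : ℝ) ≤ (n : ℝ) ^ κ := Real.one_le_rpow (by exact_mod_cast hn) hκ.le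
  have h2 : (1 : ℝ) ≤ (⌊(n : ℝ) ^ κ⌋₊ : ℝ) := by exact_mod_cast Nat.le_floor (by simpa using h1)
  have h3 := Nat.lt_floor_add_one ((n : ℝ) ^ κ)
  linarith

theorem floor_rpow_le_self {κ : ℝ} (hκ : 0 < κ) (hκ1 : κ ≤ 1) (n : ℕ) : ⌊(n : ℝ) ^ κ⌋₊ ≤ n := by
  rcases Nat.eq_zero_or_pos n with rfl | hn
  · simp [Real.zero_rpow hκ.ne']
  · refine Nat.floor_le_of_le ?_
    simpa using Real.rpow_le_rpow_of_exponent_le (x := n) (by exact_mod_cast hn) hκ1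

theorem le_floor_rpow_of_pow_le {B : ℕ} (hB : 1 ≤ B) (n X : ℕ) (h : X ^ B ≤ n ^ (B - 1)) :
    X ≤ ⌊(n : ℝ) ^ (1 - 1 / (B : ℝ))⌋₊ := by
  have hB0 : (B : ℝ) ≠ 0 := by positivity
  refine Nat.le_floor ?_
  refine le_of_pow_le_pow_left₀ (by omega : B ≠ 0) (by positivity) ?_
  rw [← Real.rpow_natCast (_ ^ _), ← Real.rpow_mul (Nat.cast_nonneg _), sub_mul,
    one_div_mul_cancel hB0, one_mul, ← Nat.cast_one (R := ℝ), ← Nat.cast_sub hB,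
    Real.rpow_natCast]
  exact_mod_cast h

/-- The exceptional probability in the dense case is smaller than any inverse polynomial. -/
theorem eventually_mul_exp_neg_le {κ β : ℝ} (hκ : 0 < κ) (hβ : 0 < β) (h : 1 < κ * (1 + β)) :
    ∀ᶠ n : ℕ in atTop, (n : ℝ) * Real.exp (-((⌊(n : ℝ) ^ κ⌋₊ : ℝ) ^ (1 + β) / n)) ≤
      (n : ℝ) ^ (-1 : ℝ) := by
  set τ := κ * (1 + β) - 1 with hτ
  have hτ0 : 0 < τ := by linarith
  set d : ℝ := 1 / 2 ^ (1 + β) with hd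
  have hd0 : 0 < d := by positivity
  have h1 := (isLittleO_exp_neg_mul_rpow_atTop hd0 (-2 / τ)).bound one_pos
  have h2 := ((tendsto_rpow_atTop hτ0).comp tendsto_natCast_atTop_atTop).eventually h1
  filter_upwards [h2, eventually_ge_atTop 1] with n h2 hn
  have hpos : (0 : ℝ) < n := by exact_mod_cast hn
  have h3 : d * (n : ℝ) ^ τ ≤ (⌊(n : ℝ) ^ κ⌋₊ : ℝ) ^ (1 + β) / n := by
    rw [le_div_iff₀ hpos]
    calc d * (n : ℝ) ^ τ * n = ((n : ℝ) ^ κ / 2) ^ (1 + β) := by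
          rw [Real.div_rpow (by positivity) (by norm_num), ← Real.rpow_mul hpos.le, mul_assoc,
            ← Real.rpow_add_one hpos.ne', hτ, sub_add_cancel, hd]
          ring
      _ ≤ _ := Real.rpow_le_rpow (by positivity) (half_rpow_le_floor hκ hn) (by linarith)
  simp only [Function.comp_apply, Real.norm_eq_abs, Real.abs_exp, one_mul] at h2
  rw [abs_of_nonneg (by positivity), ← Real.rpow_mul hpos.le, mul_div_cancel₀ _ hτ0.ne'] at h2
  calc (n : ℝ) * Real.exp (-((⌊(n : ℝ) ^ κ⌋₊ : ℝ) ^ (1 + β) / n))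
      ≤ n * Real.exp (-d * (n : ℝ) ^ τ) := by
        gcongr
        linarith
    _ ≤ n * (n : ℝ) ^ (-2 : ℝ) := by gcongr
    _ = (n : ℝ) ^ (-1 : ℝ) := by
        rw [← Real.rpow_one_add' hpos.le (by norm_num)]
        norm_num

/-- The exceptional probability in the sparse case. -/
theorem eventually_sparse_le {α : ℝ} {B G r : ℕ} (hB : 1 ≤ B)
    (hr : 1 + α < (r : ℝ) / B) {c : ℝ} (hc : 0 < c) (hc1 : 2 * c ≤ 1)
    (hcG : 2 * c ≤ (G : ℝ) / B - (1 + α)) :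
    ∀ᶠ n : ℕ in atTop, (n : ℝ) ^ (1 + α - G / B) +
      (n : ℝ) ^ ⌊(n : ℝ) ^ (1 - 1 / (B : ℝ))⌋₊ * ((⌊(n : ℝ) ^ (1 - 1 / (B : ℝ))⌋₊ : ℝ) ^ r *
        (n : ℝ) ^ (α - ((r : ℝ) - 1))) ^ 2 ^ Nat.log 2 n ≤ (n : ℝ) ^ (-c) := by
  have hB0 : (0 : ℝ) < B := by positivity
  set τ := (r : ℝ) / B - (1 + α) with hτ
  have hτ0 : 0 < τ := by linarith
  have hlt : 1 - 1 / (B : ℝ) < 1 := by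
    have : 0 < 1 / (B : ℝ) := by positivity
    linarith
  filter_upwards [eventually_const_mul_rpow_le (C := 2) (show -(2 * c) < -c by linarith),
    eventually_const_mul_rpow_le (C := 4 / τ) hlt, eventually_ge_atTop 1,
    eventually_ge_atTop ⌈4 / τ⌉₊] with n h1 h2 hn h3
  have hpos : (0 : ℝ) < n := by exact_mod_cast hn
  have hone : (1 : ℝ) ≤ n := by exact_mod_cast hn
  set u := ⌊(n : ℝ) ^ (1 - 1 / (B : ℝ))⌋₊ with hu
  have hun : (u : ℝ) ≤ (n : ℝ) ^ (1 - 1 / (B : ℝ)) := Nat.floor_le (by positivity)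
  have hl : (n : ℝ) / 2 ≤ (2 ^ Nat.log 2 n : ℕ) := by
    have h4 := Nat.lt_pow_succ_log_self (b := 2) (by norm_num) n
    have h5 : (n : ℝ) ≤ (2 ^ (Nat.log 2 n + 1) : ℕ) := by exact_mod_cast h4.le
    rw [pow_succ, Nat.cast_mul, Nat.cast_two] at h5
    linarith
  have hfirst : (n : ℝ) ^ (1 + α - G / B) ≤ (n : ℝ) ^ (-(2 * c)) :=
    Real.rpow_le_rpow_of_exponent_le hone (by linarith)
  have hbase : (u : ℝ) ^ r * (n : ℝ) ^ (α - ((r : ℝ) - 1)) ≤ (n : ℝ) ^ (-τ) := by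
    calc _ ≤ ((n : ℝ) ^ (1 - 1 / (B : ℝ))) ^ r * (n : ℝ) ^ (α - ((r : ℝ) - 1)) := by gcongr
      _ = (n : ℝ) ^ (-τ) := by
        rw [← Real.rpow_natCast (_ ^ _), ← Real.rpow_mul hpos.le, ← Real.rpow_add hpos]
        congr 1
        rw [hτ]
        ring
  have hsecond : (n : ℝ) ^ u * ((u : ℝ) ^ r * (n : ℝ) ^ (α - ((r : ℝ) - 1))) ^ 2 ^ Nat.log 2 n ≤
      (n : ℝ) ^ (-(2 * c)) := by
    calc _ ≤ (n : ℝ) ^ u * ((n : ℝ) ^ (-τ)) ^ 2 ^ Nat.log 2 n := by gcongr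
      _ = (n : ℝ) ^ ((u : ℝ) + -τ * (2 ^ Nat.log 2 n : ℕ)) := by
        rw [← Real.rpow_natCast _ (2 ^ _), ← Real.rpow_mul hpos.le, ← Real.rpow_natCast _ u,
          ← Real.rpow_add hpos]
      _ ≤ (n : ℝ) ^ (-(2 * c)) := by
        refine Real.rpow_le_rpow_of_exponent_le hone ?_
        rw [Real.rpow_one] at h2
        have h4 : 4 / τ ≤ n := (Nat.le_ceil _).trans (by exact_mod_cast h3)
        rw [div_le_iff₀ hτ0] at h4
        have h5 : (u : ℝ) ≤ n * τ / 4 := by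
          have := (mul_le_mul_of_nonneg_left hun (by positivity : 0 ≤ 4 / τ)).trans h2
          rw [div_mul_eq_mul_div, div_le_iff₀ hτ0] at this
          linarith
        have h6 := mul_le_mul_of_nonneg_left hl hτ0.le
        linarith
  linarith

end

/-! ### Hardness of approximation -/

section

variable {P : Instance → Prop} {ρ : Instance → ℝ}

/-- The class `P` contains the instances of the reduction, with or without an apex. -/
def ContainsReduction (P : Instance → Prop) : Prop :=
  ∃ a ≤ 1, ∀ (ℓ N : ℕ) (g : List ℕ) (E : List (List ℕ)), (∀ y ∈ g, y < ℓ) →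
    g.length = E.length → allGroupsHit ℓ g = true → P (reductionInstance a ℓ N g E)

/-- The reduction for concrete exponents: the planted part has `n ^ κ` vertices, and an algorithm
with ratio `O(n ^ θ)` on the instances of the reduction finds a path with at most `n ^ (θ + κ)`
colors, up to a constant, which is below the threshold `n ^ (1 - 1 / B)`. The conjecture is applied
with some uniformity `r > B * (1 + α)`. -/
theorem not_polyTimeApproximable (hDvR : DenseVsRandomConjecture) (hP : ContainsReduction P)
    {B G : ℕ} {α β κ θ C : ℝ} (hB : 2 ≤ B) (hβ : 0 < β) (hβα : β < α) (hκ : 0 < κ) (hκ1 : κ ≤ 1)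
    (hlow : 1 < κ * (1 + β)) (hhigh : κ * (1 + β) ≤ (1 + α) / 2) (hG : 1 + α < (G : ℝ) / B)
    (hθ : θ + κ < 1 - 1 / (B : ℝ))
    (hρ : ∀ᶠ n : ℕ in atTop, ∀ M : ℕ, M ^ B ≤ n ^ G → ∀ I : Instance, I.m = n →
      I.n ≤ n + 2 + M → 0 ≤ ρ I ∧ ρ I ≤ C * (n : ℝ) ^ θ) : ¬ PolyTimeApproximable P ρ := by
  intro h
  obtain ⟨a, ha, hP⟩ := hP
  have hB0 : (0 : ℝ) < B := by positivity
  have hB2 : (2 : ℝ) ≤ B := by exact_mod_cast hB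
  obtain ⟨r, hr⟩ := exists_nat_gt ((B : ℝ) * (1 + α))
  have hrB : 1 + α < (r : ℝ) / B := by rw [lt_div_iff₀ hB0]; linarith
  have hrα : α < (r : ℝ) - 1 := by nlinarith
  let c : ℝ := min 1 ((G : ℝ) / B - (1 + α)) / 2
  have hc : 0 < c := half_pos (lt_min one_pos (by linarith))
  have hc1 : 2 * c ≤ 1 := by
    rw [mul_div_cancel₀ _ two_ne_zero]; exact min_le_left _ _
  have hcG : 2 * c ≤ (G : ℝ) / B - (1 + α) := by
    rw [mul_div_cancel₀ _ two_ne_zero]; exact min_le_right _ _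
  have hB1 : 0 < 1 - 1 / (B : ℝ) := by
    rw [sub_pos, div_lt_one hB0]; linarith
  refine hDvR r α β hβ hβα hrα (fun n => ⌊(n : ℝ) ^ κ⌋₊) (floor_rpow_le_self hκ hκ1)
    ⟨κ / 2, half_pos hκ, ?_⟩ (fun n => ?_)
    (DenseVsRandomSolvable.of_approximable h ha (by omega) hP (u := fun n =>
      ⌊(n : ℝ) ^ (1 - 1 / (B : ℝ))⌋₊) hrα.le hc ?_ (floor_rpow_le_self hB1 (by
        have : 0 < 1 / (B : ℝ) := by positivity
        linarith))
      (le_floor_rpow_of_pow_le (by omega)) ?_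
      (eventually_sparse_le (by omega) hrB hc hc1 hcG))
  · filter_upwards [eventually_const_mul_rpow_le (C := 2) (show κ / 2 < κ by linarith),
      eventually_ge_atTop 1] with n h1 hn
    have := half_rpow_le_floor hκ hn
    linarith
  · rcases Nat.eq_zero_or_pos n with rfl | hn
    · rw [Nat.cast_zero, Real.zero_rpow hκ.ne', Nat.floor_zero, Nat.cast_zero,
        Real.zero_rpow (by linarith)]
      positivity
    · have hone : (1 : ℝ) ≤ n := by exact_mod_cast hn
      calc (⌊(n : ℝ) ^ κ⌋₊ : ℝ) ^ (1 + β) ≤ ((n : ℝ) ^ κ) ^ (1 + β) :=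
            Real.rpow_le_rpow (Nat.cast_nonneg _) (Nat.floor_le (by positivity)) (by linarith)
        _ = (n : ℝ) ^ (κ * (1 + β)) := by rw [← Real.rpow_mul (Nat.cast_nonneg _)]
        _ ≤ _ := Real.rpow_le_rpow_of_exponent_le hone hhigh
  · filter_upwards [hρ, eventually_const_mul_rpow_le (C := C) hθ, eventually_ge_atTop 1]
      with n hρ h1 hn M hM I hm hI
    have hpos : (0 : ℝ) < n := by exact_mod_cast hn
    obtain ⟨h2, h3⟩ := hρ M hM I hm hI
    refine ⟨h2, ?_⟩
    have h4 : ρ I * (⌊(n : ℝ) ^ κ⌋₊ : ℝ) ≤ (n : ℝ) ^ (1 - 1 / (B : ℝ)) := by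
      calc _ ≤ C * (n : ℝ) ^ θ * (n : ℝ) ^ κ := by
            gcongr
            · exact h2.trans h3
            · exact Nat.floor_le (by positivity)
        _ = C * (n : ℝ) ^ (θ + κ) := by rw [Real.rpow_add hpos, mul_assoc]
        _ ≤ _ := h1
    calc _ ≤ ((n : ℝ) ^ (1 - 1 / (B : ℝ))) ^ B := pow_le_pow_left₀ (by positivity) h4 B
      _ = (n : ℝ) ^ (B - 1) := by
        rw [← Real.rpow_natCast (_ ^ _), ← Real.rpow_mul hpos.le, sub_mul,
          one_div_mul_cancel hB0.ne', one_mul, ← Nat.cast_one (R := ℝ),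
          ← Nat.cast_sub (by omega), Real.rpow_natCast]
  · filter_upwards [eventually_mul_exp_neg_le hκ hβ hlow, eventually_ge_atTop 1] with n h1 hn
    refine h1.trans (Real.rpow_le_rpow_of_exponent_le (by exact_mod_cast hn) (by linarith))

theorem PolyTimeApproximable.mono {ρ' : Instance → ℝ} (h : PolyTimeApproximable P ρ)
    (hρ : ∀ I, ρ I ≤ ρ' I) : PolyTimeApproximable P ρ' := by
  obtain ⟨p, T, h⟩ := h
  refine ⟨p, T, fun I hI hr => ?_⟩
  obtain ⟨w, τ, h1, h2, h3, h4⟩ := h I hI hr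
  exact ⟨w, τ, h1, h2, h3, fun w' hw' => (h4 w' hw').trans
    (mul_le_mul_of_nonneg_right (hρ I) (Nat.cast_nonneg _))⟩

theorem hardToApproximate_colors (hDvR : DenseVsRandomConjecture) (hP : ContainsReduction P)
    {ε : ℝ} (hε : 0 < ε) (C : ℝ) :
    ¬ PolyTimeApproximable P fun I => C * (I.m : ℝ) ^ (1 - ε) := by
  intro h
  -- The planted part has `n ^ κ` vertices and `n ^ 2` hyperedges, and the threshold for the number
  -- of colors is `n ^ (1 - 1 / B)`.
  let κ : ℝ := min ε 1 / 3
  have hκ : 0 < κ := by positivity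
  have hκ1 : κ ≤ 1 / 3 := by
    have : min ε 1 ≤ 1 := min_le_right _ _
    change min ε 1 / 3 ≤ _
    linarith
  have hκε : 3 * κ ≤ ε := by
    rw [mul_div_cancel₀ _ (by norm_num)]; exact min_le_left _ _
  obtain ⟨B, hB⟩ := exists_nat_gt (1 / κ)
  have hB3 : (3 : ℝ) < B := by
    refine lt_of_le_of_lt ?_ hB
    rw [le_div_iff₀ hκ]; linarith
  have hBκ : 1 / (B : ℝ) < κ := by
    rw [div_lt_iff₀ (by linarith)]
    rw [div_lt_iff₀ hκ] at hB
    linarith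
  have hκinv : 6 ≤ 2 / κ := by rw [le_div_iff₀ hκ]; linarith
  have hκβ : κ * (1 + (2 / κ - 1)) = 2 := by field_simp; ring
  obtain ⟨G, hG⟩ := exists_nat_gt ((B : ℝ) * (1 + 2 / κ))
  refine not_polyTimeApproximable hDvR hP (B := B) (G := G) (α := 2 / κ) (β := 2 / κ - 1) (κ := κ)
    (θ := 1 - ε) (C := |C|) (by exact_mod_cast (by linarith : (2 : ℝ) ≤ B)) (by linarith)
    (by linarith) hκ (by linarith) (by linarith) (by linarith)
    (by rw [lt_div_iff₀ (by linarith)]; linarith) (by linarith) ?_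
    (h.mono fun I => mul_le_mul_of_nonneg_right (le_abs_self C) (by positivity))
  refine Eventually.of_forall fun n M _ I hm _ => ?_
  rw [hm]
  exact ⟨by positivity, le_rfl⟩

theorem hardToApproximate_vertices (hDvR : DenseVsRandomConjecture) (hP : ContainsReduction P)
    {ε : ℝ} (hε : 0 < ε) (C : ℝ) :
    ¬ PolyTimeApproximable P fun I => C * (I.n : ℝ) ^ (1 / 4 - ε) := by
  intro h
  -- The planted part has `n ^ (1 / 2)` vertices and slightly more than `n` hyperedges, a random
  -- hypergraph has slightly more than `n ^ 2` hyperedges.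
  let δ : ℝ := min ε (1 / 4)
  have hδ : 0 < δ := lt_min hε (by norm_num)
  have hδε : δ ≤ ε := min_le_left _ _
  have hδ4 : δ ≤ 1 / 4 := min_le_right _ _
  obtain ⟨B, hB⟩ := exists_nat_gt (2 / δ)
  have hB8 : (8 : ℝ) < B := by
    refine lt_of_le_of_lt ?_ hB
    rw [le_div_iff₀ hδ]; linarith
  have hB0 : (0 : ℝ) < B := by linarith
  have hBδ : 1 / (B : ℝ) < δ / 2 := by
    rw [div_lt_iff₀ hB0]
    rw [div_lt_iff₀ hδ] at hB
    linarith
  have hBpos : 0 < 1 / (B : ℝ) := by positivity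
  have hGB : ((2 * B + 5 : ℕ) : ℝ) / B = 2 + 5 * (1 / (B : ℝ)) := by
    push_cast; field_simp
  refine not_polyTimeApproximable hDvR hP (B := B) (G := 2 * B + 5) (α := 1 + 4 * (1 / (B : ℝ)))
    (β := 1 + 2 * (1 / (B : ℝ))) (κ := 1 / 2)
    (θ := ((2 * B + 5 : ℕ) : ℝ) / B * (1 / 4 - δ)) (C := |C| * 4 ^ (1 / 4 - δ))
    (by exact_mod_cast (by linarith : (2 : ℝ) ≤ B)) (by linarith) (by linarith) (by norm_num)
    (by norm_num) (by linarith) (by linarith) (by rw [hGB]; linarith) ?_ ?_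
    (h.mono fun I => mul_le_mul_of_nonneg_right (le_abs_self C) (by positivity))
  · rw [hGB]
    nlinarith [mul_pos hBpos hδ]
  · filter_upwards [eventually_ge_atTop 1] with n hn M hM I hm hI
    refine ⟨by positivity, ?_⟩
    have hone : (1 : ℝ) ≤ n := by exact_mod_cast hn
    have hIn : (1 : ℝ) ≤ I.n := by exact_mod_cast (Nat.zero_le _).trans_lt I.s.2
    set γ := ((2 * B + 5 : ℕ) : ℝ) / B with hγ
    have hγ1 : 1 ≤ γ := by rw [hGB]; linarith
    have hMγ : (M : ℝ) ≤ (n : ℝ) ^ γ := by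
      have hBn : B ≠ 0 := by rintro rfl; simp at hB0
      refine le_of_pow_le_pow_left₀ hBn (by positivity) ?_
      rw [← Real.rpow_natCast (_ ^ _), ← Real.rpow_mul (by linarith), hγ,
        div_mul_cancel₀ _ hB0.ne', Real.rpow_natCast]
      exact_mod_cast hM
    have hnγ : (n : ℝ) ≤ (n : ℝ) ^ γ := by
      simpa using Real.rpow_le_rpow_of_exponent_le hone hγ1
    have h2 : (I.n : ℝ) ≤ 4 * (n : ℝ) ^ γ := by
      have : (I.n : ℝ) ≤ n + 2 + M := by exact_mod_cast hI
      linarith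
    rw [mul_assoc]
    refine mul_le_mul_of_nonneg_left ?_ (abs_nonneg C)
    calc (I.n : ℝ) ^ (1 / 4 - ε) ≤ (I.n : ℝ) ^ (1 / 4 - δ) :=
          Real.rpow_le_rpow_of_exponent_le hIn (by linarith)
      _ ≤ (4 * (n : ℝ) ^ γ) ^ (1 / 4 - δ) :=
          Real.rpow_le_rpow (by linarith) h2 (by linarith)
      _ = _ := by
          rw [Real.mul_rpow (by norm_num) (by positivity), ← Real.rpow_mul (by linarith)]

theorem hardToApproximate (hDvR : DenseVsRandomConjecture) (hP : ContainsReduction P)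
    {ε : ℝ} (hε : 0 < ε) : HardToApproximate P ε :=
  ⟨hardToApproximate_colors hDvR hP hε, hardToApproximate_vertices hDvR hP hε⟩

end

end MinColorPath

theorem theorem2 (hDvR : MinColorPath.DenseVsRandomConjecture) (ε : ℝ) (hε : 0 < ε) :
    MinColorPath.HardToApproximate (fun _ => True) ε ∧
    MinColorPath.HardToApproximate (fun I => MinColorPath.IsDiamondPath I.G) ε ∧
    MinColorPath.HardToApproximate
      (fun I => (∃ v, MinColorPath.IsDiamondPath (I.G.induce {v}ᶜ)) ∧ I.ColorConnected) ε :=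
  ⟨MinColorPath.hardToApproximate hDvR ⟨0, zero_le_one, fun _ _ _ _ _ _ _ => trivial⟩ hε,
    MinColorPath.hardToApproximate hDvR ⟨0, zero_le_one, fun _ _ _ _ hg _ hhit =>
      MinColorPath.isDiamondPath_reductionInstance hg hhit⟩ hε,
    MinColorPath.hardToApproximate hDvR ⟨1, le_rfl, fun _ _ _ _ hg hE hhit =>
      ⟨MinColorPath.isDiamondPath_reductionInstance_apex hg hhit,
        MinColorPath.colorConnected_reductionInstance hE⟩⟩ hε⟩
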